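/- **Setting.** Let $(\Omega,\mathcal F,\mathbb P)$ be a probability space and $\sigma\colon\Omega\to\Omega$ an invertible (bimeasurable) ergodic measure-preserving transformation. Let $X$ be a compact metric space with its Borel $\sigma$-algebra $\mathcal G$, and let $\mathcal X\subset\Omega\times X$ be an $\mathcal F\otimes\mathcal G$-measurable set with compact fibers $X_\omega=\{x:(\omega,x)\in\mathcal X\}$. For each $\omega$ let $m_\omega$ be a Borel probability measure on $X_\omega$ such that $\omega\mapsto\int_{X_\omega}g(\omega,x)\,dm_\omega(x)$ is measurable for every measurable $g\colon\mathcal X\to\mathbb R$, and let $T_\omega\colon X_\omega\to X_{\sigma\omega}$ be maps such that $(\omega,x)\mapsto T_\omega(x)$ is measurable on $\mathcal X$ and $(T_\omega)_*m_\omega\ll m_{\sigma\omega}$. Let $L_\omega\colon L^1(m_\omega)\to L^1(m_{\sigma\omega})$ (complex $L^1$ spaces) be the transfer operator, characterized by $\int (L_\omega\varphi)\psi\,dm_{\sigma\omega}=\int\varphi\,(\psi\circ T_\omega)\,dm_\omega$ for $\psi\in L^\infty(m_{\sigma\omega})$, and $L^{(n)}_\omega=L_{\sigma^{n-1}\omega}\circ\dots\circ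 L_\omega$. Assume that for every measurable $g\colon\mathcal X\to\mathbb R$ with $g(\omega,\cdot)\in L^1(m_\omega)$ for a.e. $\omega$, the family $L_\omega(g(\omega,\cdot))$ has a jointly measurable version. Each fiber carries a variation $\mathrm{var}_\omega\colon L^1(m_\omega)\to[0,\infty]$ such that, for all $g,h,f\in L^1(m_\omega)$ and $t\in\mathbb C$: (V1) $\mathrm{var}(th)=|t|\,\mathrm{var}(h)$; (V2) $\mathrm{var}(g+h)\le\mathrm{var}(g)+\mathrm{var}(h)$; (V3) $\|h\|_{L^\infty}\le C_{\mathrm{var}}(\|h\|_{L^1}+\mathrm{var}(h))$ with $C_{\mathrm{var}}$ independent of $\omega$; (V4) for every $R\geq 0$, $\{h:\|h\|_{L^1}+\mathrm{var}(h)\le R\}$ is compact in $L^1(m_\omega)$; (V5) $\mathrm{var}(1)<\infty$; (V6) $\{h\ge0:\|h\|_{L^1}=1,\ \mathrm{var}(h)<\infty\}$ is $L^1$-dense in $\{h\ge0:\|h\|_{L^1}=1\}$; (V7) $\mathrm{var}(1/f)\le\mathrm{var}(f)/(\operatorname{ess\,inf}f)^2$ if $f$ is real with $\operatorname{ess\,inf}f>0$;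 (V8) $\mathrm{var}(fg)\le\|f\|_{L^\infty}\mathrm{var}(g)+\|g\|_{L^\infty}\mathrm{var}(f)$; (V9) $\mathrm{var}(h\circ f)\le\|h'\|_{L^\infty}\mathrm{var}(f)$ for $M>0$, measurable $f\colon X_\omega\to[-M,M]$ and $h\colon[-M,M]\to\mathbb C$ of class $C^1$. Let $\mathcal B_\omega=\{\varphi\in L^1(m_\omega):\mathrm{var}_\omega(\varphi)<\infty\}$ with norm $\|\varphi\|_{\mathcal B_\omega}=\|\varphi\|_{L^1(m_\omega)}+\mathrm{var}_\omega(\varphi)$, and let $\mathcal B_\omega^*$ be its dual. The family $(L_\omega)$ is *admissible* if: (a) there is $K>0$ with $\|L_\omega\varphi\|_{\mathcal B_{\sigma\omega}}\le K\|\varphi\|_{\mathcal B_\omega}$ for a.e. $\omega$ and all $\varphi\in\mathcal B_\omega$; (b) there are $D,\kappa>0$ with $\|L^{(n)}_\omega\varphi\|_{\mathcal B_{\sigma^n\omega}}\le De^{-\kappa n}\|\varphi\|_{\mathcal B_\omega}$ for a.e. $\omega$, all $n$ and all $\varphi\in\mathcal B_\omega$ with $\int\varphi\,dm_\omega=0$;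 (c) for every $a>0$ there are $c>0$ and $n_0\in\mathbb N$ such that $\operatorname{ess\,inf}L^{(n)}_\omega\varphi\ge c\|\varphi\|_{L^1(m_\omega)}$ for a.e. $\omega$, all $n\ge n_0$ and all $\varphi\in\mathcal B_\omega$ with $\varphi\ge0$ and $\mathrm{var}_\omega(\varphi)\le a\int\varphi\,dm_\omega$. **Theorem.** Let $(L_\omega)$ be admissible and let $F\colon\mathcal X\to\mathbb R$ be measurable with $F(\omega,\cdot)\in\mathcal B_\omega$ for all $\omega$ and $\operatorname{ess\,sup}_\omega\|F(\omega,\cdot)\|_{\mathcal B_\omega}<\infty$. There is an essentially unique measurable $v\colon\mathcal X\to[0,\infty)$, $v_\omega=v(\omega,\cdot)$, with $\int v_\omega\,dm_\omega=1$ and $L_\omega v_\omega=v_{\sigma\omega}$ for a.e. $\omega$. For a.e. $\omega$ and all $\theta\in\mathbb C$, $L^\theta_\omega\varphi:=L_\omega(e^{\theta F(\omega,\cdot)}\varphi)$ defines a bounded operator $\mathcal B_\omega\to\mathcal B_{\sigma\omega}$; put $L^{\theta,(n)}_\omega=L^\theta_{\sigma^{n-1}\omega}\circ\dots\circ L^\theta_\omega$.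 There exist an open neighborhood $U$ of $0$ in $\mathbb C$ and, for each $\theta\in U$, a family $(\lambda_\omega^\theta,v_\omega^\theta,\phi_\omega^\theta)\in\mathbb C\times\mathcal B_\omega\times\mathcal B_\omega^*$, $\omega\in\Omega$, such that: 1. for a.e. $\omega$ and every $\theta\in U$: $L^\theta_\omega v^\theta_\omega=\lambda^\theta_\omega v^\theta_{\sigma\omega}$, $(L^\theta_\omega)^*\phi^\theta_{\sigma\omega}=\lambda^\theta_\omega\phi^\theta_\omega$ and $\phi^\theta_\omega(v^\theta_\omega)=1$; 2. for a.e. $\omega$: $\lambda^0_\omega=1$, $v^0_\omega=v_\omega$ and $\phi^0_\omega(\varphi)=\int\varphi\,dm_\omega$ for all $\varphi\in\mathcal B_\omega$; 3. for a.e. $\omega$ the maps $\theta\mapsto\lambda^\theta_\omega\in\mathbb C$, $\theta\mapsto v^\theta_\omega\in\mathcal B_\omega$, $\theta\mapsto\phi^\theta_\omega\in\mathcal B^*_\omega$ are analytic on $U$; 4. for each $\theta\in U$: $\omega\mapsto\lambda^\theta_\omega$ is measurable; $(\omega,x)\mapsto v^\theta_\omega(x)$ is measurable on $\mathcal X$ (for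 suitable representatives of the classes $v_\omega^\theta$); and $\omega\mapsto\phi^\theta_\omega(g(\omega,\cdot))$ is measurable for every measurable $g\colon\mathcal X\to\mathbb C$ with $g(\omega,\cdot)\in\mathcal B_\omega$ for all $\omega$; 5. there is $C>0$ with $\max\{|\lambda^\theta_\omega|,\|v^\theta_\omega\|_{\mathcal B_\omega},\|\phi^\theta_\omega\|_{\mathcal B^*_\omega}\}\le C$ for a.e. $\omega$ and every $\theta\in U$; 6. there are $c>0$ and $r\in(0,1)$ such that for a.e. $\omega$, all $n\in\mathbb N$, $\varphi\in\mathcal B_\omega$ and $\theta\in U$, $$\Big\|L^{\theta,(n)}_\omega\varphi-\Big(\prod_{i=0}^{n-1}\lambda^\theta_{\sigma^i\omega}\Big)\phi^\theta_\omega(\varphi)\,v^\theta_{\sigma^n\omega}\Big\|_{\mathcal B_{\sigma^n\omega}}\le c\,r^n\|\varphi\|_{\mathcal B_\omega}.$$ -/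

import Mathlib

open MeasureTheory Filter Topology
open scoped ENNReal NNReal

noncomputable section

/-- The transfer operator of a map `T : Y → Z` with respect to reference measures `μ` on `Y` and
`ν` on `Z`: the integrable function `f` is sent to the Radon-Nikodym density with respect to `ν` of
the push-forward under `T` of the complex measure `f dμ`. When `T` is measurable and
`T_* μ ≪ ν`, this is the unique `g ∈ L¹(ν)` with `∫ g ψ dν = ∫ f (ψ ∘ T) dμ` for `ψ ∈ L^∞(ν)`. -/
def transferL1 {Y Z : Type*} [MeasurableSpace Y] [MeasurableSpace Z]
    (T : Y → Z) (μ : Measure Y) (ν : Measure Z) (f : Y → ℂ) : Lp ℂ 1 ν :=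
  (ComplexMeasure.integrable_rnDeriv (VectorMeasure.map (μ.withDensityᵥ f) T) ν).toL1 _

/-- `φ ∈ L¹` takes real non-negative values. -/
def NonnegL1 {Y : Type*} [MeasurableSpace Y] {μ : Measure Y} (φ : Lp ℂ 1 μ) : Prop :=
  ∀ᵐ x ∂μ, (φ x).im = 0 ∧ 0 ≤ (φ x).re

/-- A notion of variation on the (complex) space `L¹(Y, μ)`: a map `var : L¹ → [0, ∞]` with
properties (V1)-(V9), where `C` is the constant in (V3). -/
structure Variation {Y : Type*} [MeasurableSpace Y] (μ : Measure Y) (C : ℝ≥0) where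
  var : Lp ℂ 1 μ → ℝ≥0∞
  var_smul : ∀ (t : ℂ) (h : Lp ℂ 1 μ), var (t • h) = ‖t‖ₑ * var h
  var_add : ∀ g h : Lp ℂ 1 μ, var (g + h) ≤ var g + var h
  eLpNorm_top_le : ∀ h : Lp ℂ 1 μ, eLpNorm h ∞ μ ≤ C * (‖h‖ₑ + var h)
  isCompact_ball : ∀ R : ℝ≥0, IsCompact {h : Lp ℂ 1 μ | ‖h‖ₑ + var h ≤ R}
  var_one : ∀ h : Lp ℂ 1 μ, h =ᵐ[μ] (fun _ => (1 : ℂ)) → var h < ∞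
  dense : {h : Lp ℂ 1 μ | NonnegL1 h ∧ ‖h‖ = 1} ⊆
    closure {h : Lp ℂ 1 μ | NonnegL1 h ∧ ‖h‖ = 1 ∧ var h < ∞}
  /-- if `ess inf f ≥ δ > 0` then `var (1/f) ≤ var f / δ²` -/
  var_inv : ∀ (f g : Lp ℂ 1 μ) (δ : ℝ), 0 < δ →
    (∀ᵐ x ∂μ, (f x).im = 0 ∧ δ ≤ (f x).re) → (∀ᵐ x ∂μ, g x = (f x)⁻¹) →
    var g ≤ var f / ENNReal.ofReal (δ ^ 2)
  var_mul : ∀ f g k : Lp ℂ 1 μ, (∀ᵐ x ∂μ, k x = f x * g x) →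
    var k ≤ eLpNorm f ∞ μ * var g + eLpNorm g ∞ μ * var f
  /-- for `f` with values in `[-M, M]` and `h : [-M, M] → ℂ` of class `C¹` with `‖h'‖_∞ ≤ D`,
  `var (h ∘ f) ≤ D var f` -/
  var_comp : ∀ (M : ℝ) (h : ℝ → ℂ) (D : ℝ≥0) (f k : Lp ℂ 1 μ), 0 < M →
    ContDiffOn ℝ 1 h (Set.Icc (-M) M) →
    (∀ t ∈ Set.Icc (-M) M, ‖derivWithin h (Set.Icc (-M) M) t‖ ≤ D) →
    (∀ᵐ x ∂μ, (f x).im = 0 ∧ (f x).re ∈ Set.Icc (-M) M) →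
    (∀ᵐ x ∂μ, k x = h (f x).re) →
    var k ≤ D * var f

namespace Variation

variable {Y : Type*} [MeasurableSpace Y] {μ : Measure Y} {C : ℝ≥0}

/-- `‖φ‖_{L¹} + var φ ∈ [0, ∞]`. -/
def bnorm (V : Variation μ C) (φ : Lp ℂ 1 μ) : ℝ≥0∞ := ‖φ‖ₑ + V.var φ

/-- The functions of finite variation, as a subspace of `L¹`. -/
def submodule (V : Variation μ C) : Submodule ℂ (Lp ℂ 1 μ) where
  carrier := {φ | V.var φ < ∞}
  zero_mem' := by
    have h := V.var_smul 0 0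
    simp only [zero_smul, enorm_zero, zero_mul] at h
    simp [h]
  add_mem' := fun {a b} ha hb => (V.var_add a b).trans_lt (ENNReal.add_lt_top.2 ⟨ha, hb⟩)
  smul_mem' := fun c x hx => by
    simp only [Set.mem_ofPred_eq, V.var_smul] at hx ⊢
    exact ENNReal.mul_lt_top enorm_lt_top hx

/-- The space `𝓑 = {φ ∈ L¹ : var φ < ∞}`, normed by `‖φ‖_𝓑 = ‖φ‖_{L¹} + var φ`. It is a type of
its own since its norm is not the one of `L¹`. -/
def Space (V : Variation μ C) : Type _ := V.submodule

variable (V : Variation μ C)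

instance : AddCommGroup V.Space := inferInstanceAs (AddCommGroup V.submodule)

instance : Module ℂ V.Space := inferInstanceAs (Module ℂ V.submodule)

/-- The class in `L¹` of an element of `𝓑`. -/
def Space.val {V : Variation μ C} (φ : V.Space) : Lp ℂ 1 μ := Subtype.val (p := (· ∈ V.submodule)) φ

instance : Norm V.Space := ⟨fun φ => ‖φ.val‖ + (V.var φ.val).toReal⟩

theorem space_core : NormedSpace.Core ℂ V.Space where
  norm_nonneg φ := add_nonneg (norm_nonneg _) ENNReal.toReal_nonneg
  norm_smul c φ := by
    change ‖c • φ.val‖ + (V.var (c • φ.val)).toReal = ‖c‖ * (‖φ.val‖ + (V.var φ.val).toReal)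
    rw [V.var_smul, norm_smul, ENNReal.toReal_mul, toReal_enorm, mul_add]
  norm_triangle φ ψ := by
    change ‖φ.val + ψ.val‖ + (V.var (φ.val + ψ.val)).toReal ≤
      (‖φ.val‖ + (V.var φ.val).toReal) + (‖ψ.val‖ + (V.var ψ.val).toReal)
    have hφ : V.var φ.val < ∞ := Subtype.property (p := (· ∈ V.submodule)) φ
    have hψ : V.var ψ.val < ∞ := Subtype.property (p := (· ∈ V.submodule)) ψ
    have h1 := norm_add_le φ.val ψ.val
    have h2 := ENNReal.toReal_mono (ENNReal.add_lt_top.2 ⟨hφ, hψ⟩).ne (V.var_add φ.val ψ.val)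
    rw [ENNReal.toReal_add hφ.ne hψ.ne] at h2
    linarith
  norm_eq_zero_iff φ := by
    constructor
    · intro h
      change ‖φ.val‖ + (V.var φ.val).toReal = 0 at h
      have h1 : ‖φ.val‖ = 0 := by
        have := norm_nonneg φ.val
        have := ENNReal.toReal_nonneg (a := V.var φ.val)
        linarith
      exact Subtype.ext (norm_eq_zero.1 h1)
    · rintro rfl
      change ‖(0 : Lp ℂ 1 μ)‖ + (V.var (0 : Lp ℂ 1 μ)).toReal = 0
      have h := V.var_smul 0 0
      simp only [zero_smul, enorm_zero, zero_mul] at h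
      simp [h]

instance : NormedAddCommGroup V.Space := NormedAddCommGroup.ofCore V.space_core

instance : NormedSpace ℂ V.Space := NormedSpace.ofCore V.space_core

end Variation

/-- The fiber `X_ω = {x : (ω, x) ∈ 𝒳}`. -/
abbrev fiber {Ω X : Type*} (𝒳 : Set (Ω × X)) (ω : Ω) : Set X := {x | (ω, x) ∈ 𝒳}

/-- The section `g(ω, ·) : X_ω → E` of a map `g : 𝒳 → E`. -/
def sect {Ω X E : Type*} {𝒳 : Set (Ω × X)} (g : 𝒳 → E) (ω : Ω) : fiber 𝒳 ω → E :=
  fun x => g ⟨(ω, x.1), x.2⟩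

/-- The section `g(ω, ·)` of a real function on `𝒳`, as a complex-valued function. -/
def csect {Ω X : Type*} {𝒳 : Set (Ω × X)} (g : 𝒳 → ℝ) (ω : Ω) : fiber 𝒳 ω → ℂ :=
  fun x => ((sect g ω x : ℝ) : ℂ)

/-- A random dynamical system with random compact fibers, over an invertible ergodic base,
with fiberwise reference measures, transfer operators and fiberwise notions of variation. -/
structure RandomSystem (Ω X : Type*) [MeasurableSpace Ω] (ℙ : Measure Ω)
    [MetricSpace X] [MeasurableSpace X] where
  σ : Ω ≃ᵐ Ω
  ergodic : Ergodic σ ℙ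
  𝒳 : Set (Ω × X)
  measurableSet_𝒳 : MeasurableSet 𝒳
  isCompact_fiber : ∀ ω, IsCompact (fiber 𝒳 ω)
  m : ∀ ω, Measure (fiber 𝒳 ω)
  isProbabilityMeasure : ∀ ω, IsProbabilityMeasure (m ω)
  measurable_m : ∀ g : 𝒳 → ℝ, Measurable g → Measurable fun ω => ∫ x, sect g ω x ∂(m ω)
  T : ∀ ω, fiber 𝒳 ω → fiber 𝒳 (σ ω)
  measurable_T : Measurable fun p : 𝒳 => (T p.1.1 ⟨p.1.2, p.2⟩ : X)
  nonsingular : ∀ ω, (m ω).map (T ω) ≪ m (σ ω)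
  /-- the transfer operators depend measurably on `ω`: `(L_ω g(ω, ·))_ω` has a jointly measurable
  version -/
  measurable_transfer : ∀ g : 𝒳 → ℝ, Measurable g →
    (∀ᵐ ω ∂ℙ, Integrable (sect g ω) (m ω)) →
    ∃ G : 𝒳 → ℝ, Measurable G ∧ ∀ᵐ ω ∂ℙ,
      transferL1 (T ω) (m ω) (m (σ ω)) (csect g ω) =ᵐ[m (σ ω)] csect G (σ ω)
  Cvar : ℝ≥0
  V : ∀ ω, Variation (m ω) Cvar

namespace RandomSystem

variable {Ω X : Type*} [MeasurableSpace Ω] {ℙ : Measure Ω} [MetricSpace X] [MeasurableSpace X]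

/-- The space `𝓑_ω`. -/
abbrev B (S : RandomSystem Ω X ℙ) (ω : Ω) : Type _ := (S.V ω).Space

/-- The transfer operator `L_ω : L¹(m_ω) → L¹(m_{σω})` of `T_ω`. -/
def transfer (S : RandomSystem Ω X ℙ) (ω : Ω) (φ : Lp ℂ 1 (S.m ω)) : Lp ℂ 1 (S.m (S.σ ω)) :=
  transferL1 (S.T ω) (S.m ω) (S.m (S.σ ω)) φ

/-- `L_ω^{(n)} = L_{σ^{n-1}ω} ∘ ⋯ ∘ L_{σω} ∘ L_ω`. -/
def transferIter (S : RandomSystem Ω X ℙ) :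
    (n : ℕ) → (ω : Ω) → Lp ℂ 1 (S.m ω) → Lp ℂ 1 (S.m (S.σ^[n] ω))
  | 0, _, φ => φ
  | n + 1, ω, φ => transferIter S n (S.σ ω) (S.transfer ω φ)

/-- Admissibility of the family `(L_ω)` of transfer operators. -/
structure Admissible (S : RandomSystem Ω X ℙ) : Prop where
  bounded : ∃ K : ℝ, 0 < K ∧ ∀ᵐ ω ∂ℙ, ∀ φ : Lp ℂ 1 (S.m ω), (S.V ω).var φ < ∞ →
    (S.V (S.σ ω)).bnorm (S.transfer ω φ) ≤ ENNReal.ofReal K * (S.V ω).bnorm φ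
  decay : ∃ C κ : ℝ, 0 < C ∧ 0 < κ ∧ ∀ᵐ ω ∂ℙ, ∀ n : ℕ, ∀ φ : Lp ℂ 1 (S.m ω),
    (S.V ω).var φ < ∞ → ∫ x, φ x ∂(S.m ω) = 0 →
    (S.V (S.σ^[n] ω)).bnorm (S.transferIter n ω φ) ≤
      ENNReal.ofReal (C * Real.exp (-κ * n)) * (S.V ω).bnorm φ
  cone : ∀ a : ℝ, 0 < a → ∃ c : ℝ, 0 < c ∧ ∃ n₀ : ℕ, ∀ᵐ ω ∂ℙ, ∀ n ≥ n₀, ∀ φ : Lp ℂ 1 (S.m ω),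
    NonnegL1 φ → (S.V ω).var φ ≤ ENNReal.ofReal (a * ∫ x, (φ x).re ∂(S.m ω)) →
    ∀ᵐ y ∂(S.m (S.σ^[n] ω)), c * ‖φ‖ ≤ (S.transferIter n ω φ y).re

/-- `v : 𝒳 → [0, ∞)` is a measurable equivariant density: `∫ v_ω dm_ω = 1` and
`L_ω v_ω = v_{σω}` for almost every `ω`. -/
structure IsEquivariantDensity (S : RandomSystem Ω X ℙ) (v : S.𝒳 → ℝ) : Prop where
  measurable : Measurable v
  nonneg : ∀ p, 0 ≤ v p
  integral_eq_one : ∀ᵐ ω ∂ℙ, ∫ x, sect v ω x ∂(S.m ω) = 1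
  equivariant : ∀ᵐ ω ∂ℙ,
    transferL1 (S.T ω) (S.m ω) (S.m (S.σ ω)) (csect v ω) =ᵐ[S.m (S.σ ω)] csect v (S.σ ω)

/-- The bounded operator `A : 𝓑_ω → 𝓑_{σω}` is the twisted transfer operator
`L_ω^θ φ = L_ω (e^{θ F(ω, ·)} φ)`. -/
def IsTwisted (S : RandomSystem Ω X ℙ) (F : S.𝒳 → ℝ) (θ : ℂ) (ω : Ω)
    (A : S.B ω →L[ℂ] S.B (S.σ ω)) : Prop :=
  ∀ φ : S.B ω, (A φ).val = transferL1 (S.T ω) (S.m ω) (S.m (S.σ ω))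
    (fun x => Complex.exp (θ * csect F ω x) * φ.val x)

/-- The iterates `A_{σ^{n-1}ω} ∘ ⋯ ∘ A_{σω} ∘ A_ω` of a family of operators `𝓑_ω → 𝓑_{σω}`. -/
def iterOp (S : RandomSystem Ω X ℙ) (A : ∀ ω, S.B ω →L[ℂ] S.B (S.σ ω)) :
    (n : ℕ) → (ω : Ω) → S.B ω →L[ℂ] S.B (S.σ^[n] ω)
  | 0, ω => ContinuousLinearMap.id ℂ (S.B ω)
  | n + 1, ω => (iterOp S A n (S.σ ω)).comp (A ω)

/-- Measurability of a family `v_ω ∈ 𝓑_ω`: `(ω, x) ↦ v_ω(x)` is measurable on `𝒳`, for suitable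
representatives of the classes `v_ω`. -/
def MeasurableVec (S : RandomSystem Ω X ℙ) (v : ∀ ω, S.B ω) : Prop :=
  ∃ g : S.𝒳 → ℂ, Measurable g ∧ ∀ ω, (v ω).val =ᵐ[S.m ω] sect g ω

/-- Measurability of a family `φ_ω ∈ 𝓑_ω^*`: `ω ↦ φ_ω(g(ω, ·))` is measurable for each measurable
`g : 𝒳 → ℂ` with `g(ω, ·) ∈ 𝓑_ω` for all `ω`. -/
def MeasurableDual (S : RandomSystem Ω X ℙ) (φ : ∀ ω, S.B ω →L[ℂ] ℂ) : Prop :=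
  ∀ (g : S.𝒳 → ℂ) (γ : ∀ ω, S.B ω), Measurable g →
    (∀ ω, (γ ω).val =ᵐ[S.m ω] sect g ω) → Measurable fun ω => φ ω (γ ω)

end RandomSystem

end

/-!
The bounded measurable families `(h_ω)`, `h_ω ∈ 𝓑_ω`, form a Banach space on which the whole
random system acts as one operator, the equivariance `L_ω v_ω = v_{σω}` becomes a fixed-point
equation, and the eigenvalue equation for `L^θ` becomes an equation `Φ(θ, u) = 0` with `Φ` analytic.
By the decay hypothesis the derivative of `Φ(0, ·)` at the fixed point is invertible, so the
implicit function theorem gives eigenvectors that depend analytically on `θ`. Evaluation at `ω` is a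
bounded operator with norm at most one, so all the estimates hold uniformly in `ω`.

Divided by its eigenvalue, `L^θ` is a small perturbation of `L` on families of mean zero, and so
still contracts exponentially there. The dual eigenfunctional is the uniform limit of the integrals
of the normalized iterates, hence analytic in `θ`.

An equivariant density is unique because `L` is an `L¹` contraction and `𝓑_ω` is `L¹` dense among
densities: the `L¹` distance between two equivariant densities tends to zero along almost every
orbit, and `σ` preserves the measure.
-/

noncomputable section

section TransferL1

variable {Y Z : Type*} [MeasurableSpace Y] [MeasurableSpace Z] {T : Y → Z} {μ : Measure Y}
  {ν : Measure Z}

theorem withDensityᵥ_complexRnDeriv_eq [SigmaFinite ν] {c : ComplexMeasure Z}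
    (hc : c ≪ᵥ ν.toENNRealVectorMeasure) : ν.withDensityᵥ (c.rnDeriv ν) = c := by
  obtain ⟨hre, him⟩ := (ComplexMeasure.absolutelyContinuous_ennreal_iff c _).1 hc
  rw [SignedMeasure.absolutelyContinuous_iff_withDensityᵥ_rnDeriv_eq] at hre him
  have hdensity := ComplexMeasure.integrable_rnDeriv c ν
  ext s hs
  rw [withDensityᵥ_apply hdensity hs]
  apply Complex.ext
  · rw [← RCLike.re_eq_complex_re, ← integral_re hdensity.integrableOn]
    exact (withDensityᵥ_apply (SignedMeasure.integrable_rnDeriv _ _) hs).symm.trans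
      (by rw [hre]; rfl)
  · rw [← RCLike.im_eq_complex_im, ← integral_im hdensity.integrableOn]
    exact (withDensityᵥ_apply (SignedMeasure.integrable_rnDeriv _ _) hs).symm.trans
      (by rw [him]; rfl)

theorem setIntegral_transferL1 [SigmaFinite ν] (hT : Measurable T) (hac : μ.map T ≪ ν)
    {f : Y → ℂ} (hf : Integrable f μ) {s : Set Z} (hs : MeasurableSet s) :
    ∫ y in s, transferL1 T μ ν f y ∂ν = ∫ x in T ⁻¹' s, f x ∂μ := by
  set c : ComplexMeasure Z := VectorMeasure.map (μ.withDensityᵥ f) T with hc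
  have hc_apply : ∀ t, MeasurableSet t → c t = ∫ x in T ⁻¹' t, f x ∂μ := fun t ht => by
    rw [hc, VectorMeasure.map_apply _ hT ht, withDensityᵥ_apply hf (hT ht)]
  have hc_ac : c ≪ᵥ ν.toENNRealVectorMeasure := by
    refine VectorMeasure.AbsolutelyContinuous.mk fun t ht h0 => ?_
    rw [Measure.toENNRealVectorMeasure_apply_measurable ht] at h0
    have hμ := hac h0
    rw [Measure.map_apply hT ht] at hμ
    rw [hc_apply t ht, Measure.restrict_eq_zero.2 hμ, integral_zero_measure]
  have hdensity := ComplexMeasure.integrable_rnDeriv c ν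
  rw [transferL1, integral_congr_ae (ae_restrict_of_ae hdensity.coeFn_toL1), ← hc_apply s hs,
    ← withDensityᵥ_apply hdensity hs, withDensityᵥ_complexRnDeriv_eq hc_ac]

theorem transferL1_ae_eq [SigmaFinite ν] (hT : Measurable T) (hac : μ.map T ≪ ν)
    {f : Y → ℂ} (hf : Integrable f μ) {g : Z → ℂ} (hg : Integrable g ν)
    (h : ∀ s, MeasurableSet s → ∫ y in s, g y ∂ν = ∫ x in T ⁻¹' s, f x ∂μ) :
    transferL1 T μ ν f =ᵐ[ν] g :=
  Integrable.ae_eq_of_forall_setIntegral_eq _ _ (L1.integrable_coeFn _) hg fun s hs _ => by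
    rw [setIntegral_transferL1 hT hac hf hs, h s hs]

theorem transferL1_congr {f g : Y → ℂ} (h : f =ᵐ[μ] g) :
    transferL1 T μ ν f = transferL1 T μ ν g := by
  rw [transferL1, transferL1]
  congr 3
  exact WithDensityᵥEq.congr_ae h

theorem transferL1_add [SigmaFinite ν] (hT : Measurable T) (hac : μ.map T ≪ ν) {f g : Y → ℂ}
    (hf : Integrable f μ) (hg : Integrable g μ) :
    transferL1 T μ ν (f + g) = transferL1 T μ ν f + transferL1 T μ ν g := by
  refine Lp.ext (transferL1_ae_eq hT hac (hf.add hg) (L1.integrable_coeFn _) fun s hs => ?_)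
  rw [integral_congr_ae (ae_restrict_of_ae (Lp.coeFn_add _ _)),
    integral_add' (L1.integrable_coeFn _).integrableOn (L1.integrable_coeFn _).integrableOn,
    integral_add' hf.integrableOn hg.integrableOn, setIntegral_transferL1 hT hac hf hs,
    setIntegral_transferL1 hT hac hg hs]

theorem transferL1_smul [SigmaFinite ν] (hT : Measurable T) (hac : μ.map T ≪ ν) {f : Y → ℂ}
    (c : ℂ) (hf : Integrable f μ) : transferL1 T μ ν (c • f) = c • transferL1 T μ ν f := by
  refine Lp.ext (transferL1_ae_eq hT hac (hf.smul c) (L1.integrable_coeFn _) fun s hs => ?_)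
  rw [integral_congr_ae (ae_restrict_of_ae (Lp.coeFn_smul _ _))]
  simp only [Pi.smul_apply]
  rw [integral_smul, integral_smul, setIntegral_transferL1 hT hac hf hs]

theorem integral_transferL1 [SigmaFinite ν] (hT : Measurable T) (hac : μ.map T ≪ ν)
    {f : Y → ℂ} (hf : Integrable f μ) :
    ∫ y, transferL1 T μ ν f y ∂ν = ∫ x, f x ∂μ := by
  simpa using setIntegral_transferL1 hT hac hf MeasurableSet.univ

theorem integral_transferL1_mul_simpleFunc [SigmaFinite ν] (hT : Measurable T) (hac : μ.map T ≪ ν)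
    {f : Y → ℂ} (hf : Integrable f μ) (ψ : SimpleFunc Z ℂ) :
    ∫ y, transferL1 T μ ν f y * ψ y ∂ν = ∫ x, f x * ψ (T x) ∂μ := by
  have hg := L1.integrable_coeFn (transferL1 T μ ν f)
  induction ψ using SimpleFunc.induction with
  | @const c s hs =>
    have hind (z y) : z * SimpleFunc.piecewise s hs (.const Z c) (.const Z 0) y =
        s.indicator (fun _ => z * c) y := by
      by_cases hy : y ∈ s <;> simp [hy]
    simp only [hind]
    calc ∫ y, s.indicator (fun _ => transferL1 T μ ν f y * c) y ∂ν
        = ∫ y in s, transferL1 T μ ν f y * c ∂ν := integral_indicator hs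
      _ = ∫ x in T ⁻¹' s, f x * c ∂μ := by
          rw [integral_mul_const, integral_mul_const, setIntegral_transferL1 hT hac hf hs]
      _ = ∫ x, s.indicator (fun _ => f x * c) (T x) ∂μ := (integral_indicator (hT hs)).symm
  | add _ hψ hψ' =>
    simp only [SimpleFunc.coe_add, Pi.add_apply, mul_add]
    refine (integral_add (hg.mul_of_top_left (SimpleFunc.memLp_top _ ν))
      (hg.mul_of_top_left (SimpleFunc.memLp_top _ ν))).trans
        ((congrArg₂ (· + ·) hψ hψ').trans (Eq.symm ?_))
    exact integral_add (hf.mul_of_top_left ((SimpleFunc.comp _ T hT).memLp_top μ))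
      (hf.mul_of_top_left ((SimpleFunc.comp _ T hT).memLp_top μ))

theorem integral_transferL1_mul [SigmaFinite ν] (hT : Measurable T) (hac : μ.map T ≪ ν)
    {f : Y → ℂ} (hf : Integrable f μ) {ψ : Z → ℂ} (hψ : Measurable ψ) {M : ℝ}
    (hM : ∀ y, ‖ψ y‖ ≤ M) :
    ∫ y, transferL1 T μ ν f y * ψ y ∂ν = ∫ x, f x * ψ (T x) ∂μ := by
  set ψs := hψ.stronglyMeasurable.approxBounded M
  have hM0 : ∀ n y, ‖ψs n y‖ ≤ M := fun n y =>
    hψ.stronglyMeasurable.norm_approxBounded_le ((norm_nonneg _).trans (hM y)) n y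
  have hlim : ∀ y, Tendsto (fun n => ψs n y) atTop (𝓝 (ψ y)) := fun y =>
    hψ.stronglyMeasurable.tendsto_approxBounded_of_norm_le (hM y)
  have hg := L1.integrable_coeFn (transferL1 T μ ν f)
  refine tendsto_nhds_unique (tendsto_integral_of_dominated_convergence
    (F := fun n y => transferL1 T μ ν f y * ψs n y)
    (fun y => ‖transferL1 T μ ν f y‖ * M) (fun n => hg.1.mul (ψs n).aestronglyMeasurable)
    (hg.norm.mul_const M) (fun n => ae_of_all _ fun y => ?_)
    (ae_of_all _ fun y => (hlim y).const_mul _)) ?_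
  · rw [norm_mul]
    gcongr
    exact hM0 n y
  · simp only [integral_transferL1_mul_simpleFunc hT hac hf]
    refine tendsto_integral_of_dominated_convergence (fun x => ‖f x‖ * M) (fun n =>
      hf.1.mul ((ψs n).measurable.comp hT).aestronglyMeasurable)
      (hf.norm.mul_const M) (fun n => ae_of_all _ fun x => ?_)
      (ae_of_all _ fun x => (hlim (T x)).const_mul _)
    rw [norm_mul]
    gcongr
    exact hM0 n (T x)

theorem norm_transferL1_le [SigmaFinite ν] (hT : Measurable T) (hac : μ.map T ≪ ν)
    {f : Y → ℂ} (hf : Integrable f μ) : ‖transferL1 T μ ν f‖ ≤ ∫ x, ‖f x‖ ∂μ := by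
  set g := transferL1 T μ ν f
  set ψ : Z → ℂ := fun y => starRingEnd ℂ (g y) / ‖g y‖ with hψ_def
  have hψ : Measurable ψ := by
    have := (Lp.stronglyMeasurable g).measurable
    exact (Complex.continuous_conj.measurable.comp this).div
      (Complex.measurable_ofReal.comp this.norm)
  have hψ_le : ∀ y, ‖ψ y‖ ≤ 1 := fun y => by
    simpa [hψ_def] using div_self_le_one ‖g y‖
  have hgψ : ∀ y, g y * ψ y = (‖g y‖ : ℂ) := fun y => by
    rw [hψ_def, mul_div_assoc', Complex.mul_conj, Complex.normSq_eq_norm_sq, pow_two]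
    push_cast
    exact mul_self_div_self _
  calc ‖g‖ = ‖∫ y, g y * ψ y ∂ν‖ := by
        simp only [hgψ]
        rw [integral_complex_ofReal, ← L1.norm_eq_integral_norm, Complex.norm_real, norm_norm]
    _ = ‖∫ x, f x * ψ (T x) ∂μ‖ := by rw [integral_transferL1_mul hT hac hf hψ hψ_le]
    _ ≤ ∫ x, ‖f x‖ ∂μ := norm_integral_le_of_norm_le hf.norm (ae_of_all _ fun x => by
        simpa using mul_le_of_le_one_right (norm_nonneg (f x)) (hψ_le (T x)))

theorem nonnegL1_iff_norm_eq_integral {φ : Lp ℂ 1 μ} : NonnegL1 φ ↔ (‖φ‖ : ℂ) = ∫ x, φ x ∂μ := by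
  have hφ := L1.integrable_coeFn φ
  rw [L1.norm_eq_integral_norm, ← integral_complex_ofReal]
  have hnonneg (z : ℂ) : (z.im = 0 ∧ 0 ≤ z.re) ↔ ‖z‖ - z.re = 0 := by
    refine ⟨fun h => ?_, fun h => ?_⟩
    · rw [← Complex.abs_re_eq_norm.2 h.1, abs_of_nonneg h.2, sub_self]
    · have hre : 0 ≤ z.re := by linarith [norm_nonneg z]
      exact ⟨Complex.abs_re_eq_norm.1 (by rw [abs_of_nonneg hre]; linarith), hre⟩
  have hsub : 0 ≤ᵐ[μ] fun x => ‖φ x‖ - (φ x).re :=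
    ae_of_all _ fun x => sub_nonneg.2 (Complex.re_le_norm _)
  refine ⟨fun h => integral_congr_ae ?_, fun h => ?_⟩
  · filter_upwards [h] with x hx
    have := (hnonneg _).1 hx
    exact Complex.ext (by simpa using by linarith) (by simp [hx.1])
  · have h0 : ∫ x, (‖φ x‖ - (φ x).re) ∂μ = 0 := by
      rw [integral_sub hφ.norm (show Integrable (fun x => (φ x).re) μ from hφ.re)]
      have := congrArg Complex.re h
      rw [integral_complex_ofReal, Complex.ofReal_re] at this
      rw [this, sub_eq_zero]
      exact (integral_re hφ).symm
    filter_upwards [(integral_eq_zero_iff_of_nonneg_ae hsub (hφ.norm.sub hφ.re)).1 h0] with x hx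
    exact (hnonneg _).2 hx

end TransferL1

namespace Variation

variable {Y : Type*} [MeasurableSpace Y] {μ : Measure Y} {C : ℝ≥0} {V : Variation μ C}

namespace Space

/-- The element of `𝓑` given by an `L¹` class of finite variation. -/
def mk (φ : Lp ℂ 1 μ) (h : V.var φ < ∞) : V.Space := ⟨φ, h⟩

@[simp] theorem val_mk (φ : Lp ℂ 1 μ) (h : V.var φ < ∞) : (mk φ h).val = φ := rfl

@[simp] theorem val_add (φ ψ : V.Space) : (φ + ψ).val = φ.val + ψ.val := rfl

@[simp] theorem val_sub (φ ψ : V.Space) : (φ - ψ).val = φ.val - ψ.val := rfl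

@[simp] theorem val_smul (c : ℂ) (φ : V.Space) : (c • φ).val = c • φ.val := rfl

theorem val_injective : Function.Injective (Space.val (V := V)) := Subtype.val_injective

theorem ext_ae {φ ψ : V.Space} (h : φ.val =ᵐ[μ] ψ.val) : φ = ψ := val_injective (Lp.ext h)

theorem var_lt_top (φ : V.Space) : V.var φ.val < ∞ :=
  Subtype.property (p := (· ∈ V.submodule)) φ

theorem norm_def (φ : V.Space) : ‖φ‖ = ‖φ.val‖ + (V.var φ.val).toReal := rfl

theorem norm_val_le (φ : V.Space) : ‖φ.val‖ ≤ ‖φ‖ :=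
  le_add_of_nonneg_right ENNReal.toReal_nonneg

theorem bnorm_val (φ : V.Space) : V.bnorm φ.val = ENNReal.ofReal ‖φ‖ := by
  rw [norm_def, ENNReal.ofReal_add (norm_nonneg _) ENNReal.toReal_nonneg,
    ENNReal.ofReal_toReal φ.var_lt_top.ne, ofReal_norm, bnorm]

theorem norm_le_iff (φ : V.Space) {R : ℝ} (hR : 0 ≤ R) :
    ‖φ‖ ≤ R ↔ V.bnorm φ.val ≤ ENNReal.ofReal R := by
  rw [bnorm_val, ENNReal.ofReal_le_ofReal_iff hR]

end Space

/-- The inclusion of `𝓑` into `L¹`. -/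
def valCLM (V : Variation μ C) : V.Space →L[ℂ] Lp ℂ 1 μ :=
  LinearMap.mkContinuous
    { toFun := Space.val, map_add' := fun _ _ => rfl, map_smul' := fun _ _ => rfl }
    1 fun φ => by rw [one_mul]; exact φ.norm_val_le

theorem isClosed_bnorm_le (V : Variation μ C) (R : ℝ) :
    IsClosed {h : Lp ℂ 1 μ | V.bnorm h ≤ ENNReal.ofReal R} :=
  (V.isCompact_ball R.toNNReal).isClosed

theorem Space.bnorm_val_sub_le_of_tendsto {u : ℕ → V.Space} {h : Lp ℂ 1 μ}
    (hu : Tendsto (fun n => (u n).val) atTop (𝓝 h)) {ε : ℝ} (hε : 0 ≤ ε) {φ : V.Space}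
    (hφ : ∀ᶠ n in atTop, ‖φ - u n‖ ≤ ε) : V.bnorm (φ.val - h) ≤ ENNReal.ofReal ε :=
  (V.isClosed_bnorm_le ε).mem_of_tendsto (tendsto_const_nhds.sub hu)
    (hφ.mono fun n hn => (norm_le_iff (φ - u n) hε).1 hn)

-- By (V4) balls of `𝓑` are closed in `L¹`, so the `L¹` limit of a `𝓑`-Cauchy sequence is its
-- limit in `𝓑`.
instance : CompleteSpace V.Space := by
  refine Metric.complete_of_cauchySeq_tendsto fun u hu => ?_
  have hval : CauchySeq fun n => (u n).val := hu.map V.valCLM.uniformContinuous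
  obtain ⟨h, hh⟩ := cauchySeq_tendsto_of_complete hval
  have hdist : ∀ ε > 0, ∃ N, ∀ n ≥ N, V.bnorm ((u n).val - h) ≤ ENNReal.ofReal ε := fun ε hε => by
    obtain ⟨N, hN⟩ := Metric.cauchySeq_iff.1 hu ε hε
    refine ⟨N, fun n hn => Space.bnorm_val_sub_le_of_tendsto hh hε.le ?_⟩
    filter_upwards [eventually_ge_atTop N] with m hm
    rw [← dist_eq_norm]
    exact (hN n hn m hm).le
  have hfin : V.var h < ∞ := by
    obtain ⟨N, hN⟩ := hdist 1 one_pos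
    have hsub : V.var ((u N).val - h) < ∞ :=
      (le_add_self.trans (hN N le_rfl)).trans_lt ENNReal.ofReal_lt_top
    simpa using (u N - Space.mk _ hsub).var_lt_top
  refine ⟨Space.mk h hfin, Metric.tendsto_atTop.2 fun ε hε => ?_⟩
  obtain ⟨N, hN⟩ := hdist (ε / 2) (by positivity)
  refine ⟨N, fun n hn => (dist_eq_norm (u n) _).trans_lt (lt_of_le_of_lt ?_ (half_lt_self hε))⟩
  exact (Space.norm_le_iff _ (by positivity)).2 (hN n hn)

namespace Space

theorem eLpNorm_top_le (φ : V.Space) : eLpNorm φ.val ∞ μ ≤ ENNReal.ofReal (C * ‖φ‖) := by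
  rw [ENNReal.ofReal_mul (by positivity), ← bnorm_val]
  exact (V.eLpNorm_top_le φ.val).trans_eq (by simp [bnorm])

theorem ae_norm_le (φ : V.Space) : ∀ᵐ x ∂μ, ‖φ.val x‖ ≤ C * ‖φ‖ := by
  have h := φ.eLpNorm_top_le
  rw [eLpNorm_exponent_top] at h
  filter_upwards [enorm_ae_le_eLpNormEssSup φ.val μ] with x hx
  have := hx.trans h
  rwa [← ofReal_norm, ENNReal.ofReal_le_ofReal_iff (by positivity)] at this

theorem ae_tendsto {u : ℕ → V.Space} {φ : V.Space} (h : Tendsto u atTop (𝓝 φ)) :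
    ∀ᵐ x ∂μ, Tendsto (fun n => (u n).val x) atTop (𝓝 (φ.val x)) := by
  have hle : ∀ᵐ x ∂μ, ∀ n, ‖(u n).val x - φ.val x‖ ≤ C * ‖u n - φ‖ := ae_all_iff.2 fun n => by
    filter_upwards [(u n - φ).ae_norm_le, Lp.coeFn_sub (u n).val φ.val] with x hx hsub
    rwa [val_sub, hsub, Pi.sub_apply] at hx
  filter_upwards [hle] with x hx
  rw [tendsto_iff_norm_sub_tendsto_zero]
  refine squeeze_zero (fun _ => norm_nonneg _) hx ?_
  simpa using (tendsto_iff_norm_sub_tendsto_zero.1 h).const_mul (C : ℝ)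

theorem integrable_mul (f g : V.Space) : Integrable (fun x => f.val x * g.val x) μ :=
  (L1.integrable_coeFn g.val).bdd_mul (L1.integrable_coeFn f.val).aestronglyMeasurable f.ae_norm_le

theorem norm_integrable_mul_toL1_le (f g : V.Space) :
    ‖(f.integrable_mul g).toL1 _‖ ≤ C * ‖f‖ * ‖g‖ :=
  calc ‖(f.integrable_mul g).toL1 _‖
      = ∫ x, ‖f.val x * g.val x‖ ∂μ :=
        L1.norm_of_fun_eq_integral_norm _
    _ ≤ ∫ x, C * ‖f‖ * ‖g.val x‖ ∂μ := by
        refine integral_mono_ae (f.integrable_mul g).norm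
          ((L1.integrable_coeFn _).norm.const_mul _) ?_
        filter_upwards [f.ae_norm_le] with x hx
        rw [norm_mul]
        gcongr
    _ = C * ‖f‖ * ‖g.val‖ := by rw [integral_const_mul, L1.norm_eq_integral_norm]
    _ ≤ C * ‖f‖ * ‖g‖ := by gcongr; exact g.norm_val_le

theorem var_integrable_mul_toL1_le (f g : V.Space) :
    V.var ((f.integrable_mul g).toL1 _) ≤ ENNReal.ofReal (2 * C * ‖f‖ * ‖g‖) := by
  have hvar (φ : V.Space) : V.var φ.val ≤ ENNReal.ofReal ‖φ‖ := by
    rw [← bnorm_val]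
    exact le_add_self
  calc V.var ((f.integrable_mul g).toL1 _)
      ≤ eLpNorm f.val ∞ μ * V.var g.val + eLpNorm g.val ∞ μ * V.var f.val :=
        V.var_mul f.val g.val _ (f.integrable_mul g).coeFn_toL1
    _ ≤ ENNReal.ofReal (C * ‖f‖) * ENNReal.ofReal ‖g‖ +
          ENNReal.ofReal (C * ‖g‖) * ENNReal.ofReal ‖f‖ := by
        gcongr
        exacts [f.eLpNorm_top_le, hvar g, g.eLpNorm_top_le, hvar f]
    _ = ENNReal.ofReal (2 * C * ‖f‖ * ‖g‖) := by
        rw [← ENNReal.ofReal_mul (by positivity), ← ENNReal.ofReal_mul (by positivity),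
          ← ENNReal.ofReal_add (by positivity) (by positivity)]
        ring_nf

/-- The pointwise product on `𝓑`. -/
def mul (f g : V.Space) : V.Space :=
  mk ((f.integrable_mul g).toL1 _)
    ((f.var_integrable_mul_toL1_le g).trans_lt ENNReal.ofReal_lt_top)

theorem mul_ae_eq (f g : V.Space) : (f.mul g).val =ᵐ[μ] fun x => f.val x * g.val x :=
  (f.integrable_mul g).coeFn_toL1

theorem norm_mul_le (f g : V.Space) : ‖f.mul g‖ ≤ 3 * C * ‖f‖ * ‖g‖ := by
  have hvar := ENNReal.toReal_mono ENNReal.ofReal_ne_top (f.var_integrable_mul_toL1_le g)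
  rw [ENNReal.toReal_ofReal (by positivity)] at hvar
  have hval := f.norm_integrable_mul_toL1_le g
  rw [norm_def, mul, val_mk]
  linarith

end Space

/-- Multiplication by `f` as a bounded operator on `𝓑`. -/
def mulCLM (f : V.Space) : V.Space →L[ℂ] V.Space :=
  LinearMap.mkContinuous
    { toFun := fun g => f.mul g
      map_add' := fun g h => Space.ext_ae <| by
        filter_upwards [f.mul_ae_eq (g + h), f.mul_ae_eq g, f.mul_ae_eq h,
          Lp.coeFn_add g.val h.val, Lp.coeFn_add (f.mul g).val (f.mul h).val]
          with x hfgh hfg hfh hgh hadd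
        simp only [hfgh, Space.val_add, hgh, hadd, Pi.add_apply, hfg, hfh, mul_add]
      map_smul' := fun c g => Space.ext_ae <| by
        filter_upwards [f.mul_ae_eq (c • g), f.mul_ae_eq g,
          Lp.coeFn_smul c g.val, Lp.coeFn_smul c (f.mul g).val] with x hfcg hfg hcg hsmul
        simp only [hfcg, RingHom.id_apply, Space.val_smul, hcg, hsmul, Pi.smul_apply, hfg,
          smul_eq_mul, mul_left_comm] }
    (3 * C * ‖f‖) fun g => f.norm_mul_le g

theorem mulCLM_ae_eq (f g : V.Space) : (mulCLM f g).val =ᵐ[μ] fun x => f.val x * g.val x :=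
  f.mul_ae_eq g

theorem norm_mulCLM_le (f : V.Space) : ‖mulCLM f‖ ≤ 3 * C * ‖f‖ :=
  LinearMap.mkContinuous_norm_le _ (by positivity) _

theorem smul_mulCLM_pow_ae_eq (f g : V.Space) (θ : ℂ) (n : ℕ) :
    (((θ • mulCLM f) ^ n) g).val =ᵐ[μ] fun x => (θ * f.val x) ^ n * g.val x := by
  induction n with
  | zero => simp
  | succ n ih =>
    set h := ((θ • mulCLM f) ^ n) g
    have hsucc : ((θ • mulCLM f) ^ (n + 1)) g = θ • mulCLM f h := by rw [pow_succ']; rfl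
    rw [hsucc, Space.val_smul]
    filter_upwards [ih, mulCLM_ae_eq f h, Lp.coeFn_smul θ (mulCLM f h).val] with x hn hmul hsmul
    rw [hsmul, Pi.smul_apply, hmul, hn, smul_eq_mul]
    ring

theorem exp_series_mulCLM_ae_eq (f g : V.Space) (θ : ℂ) (N : ℕ) :
    ((∑ n ∈ Finset.range N, (n.factorial⁻¹ : ℂ) • (θ • mulCLM f) ^ n) g).val =ᵐ[μ]
      fun x => (∑ n ∈ Finset.range N, (n.factorial⁻¹ : ℂ) • (θ * f.val x) ^ n) * g.val x := by
  have hval : ((∑ n ∈ Finset.range N, (n.factorial⁻¹ : ℂ) • (θ • mulCLM f) ^ n) g).val =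
      ∑ n ∈ Finset.range N, (n.factorial⁻¹ : ℂ) • (((θ • mulCLM f) ^ n) g).val := by
    rw [sum_apply]
    exact map_sum V.valCLM _ _
  rw [hval]
  filter_upwards [Lp.coeFn_finsetSum (Finset.range N)
      fun n => (n.factorial⁻¹ : ℂ) • (((θ • mulCLM f) ^ n) g).val,
    ae_all_iff.2 fun n => smul_mulCLM_pow_ae_eq f g θ n,
    ae_all_iff.2 fun n : ℕ => Lp.coeFn_smul (n.factorial⁻¹ : ℂ) (((θ • mulCLM f) ^ n) g).val]
    with x hsum hpow hsmul
  rw [hsum, Finset.sum_apply, Finset.sum_mul]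
  simp only [hsmul, Pi.smul_apply, hpow, smul_eq_mul, mul_assoc]

theorem exp_mulCLM_ae_eq (f g : V.Space) (θ : ℂ) :
    (NormedSpace.exp (θ • mulCLM f) g).val =ᵐ[μ] fun x => Complex.exp (θ * f.val x) * g.val x := by
  have hop := ((ContinuousLinearMap.apply ℂ V.Space g).continuous.tendsto _).comp
    (NormedSpace.exp_series_hasSum_exp' (𝕂 := ℂ) (θ • mulCLM f)).tendsto_sum_nat
  filter_upwards [Space.ae_tendsto hop, ae_all_iff.2 (exp_series_mulCLM_ae_eq f g θ)]
    with x hlim hpart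
  refine tendsto_nhds_unique hlim ?_
  simp only [Function.comp_apply, ContinuousLinearMap.apply_apply, hpart]
  rw [Complex.exp_eq_exp_ℂ]
  exact (NormedSpace.exp_series_hasSum_exp' (𝕂 := ℂ) (θ * f.val x)).tendsto_sum_nat.mul_const _

section One

variable [IsProbabilityMeasure μ]

theorem var_toL1_one (V : Variation μ C) :
    V.var ((integrable_const (1 : ℂ)).toL1 fun _ : Y => (1 : ℂ)) = 0 := by
  have hone := (integrable_const (μ := μ) (1 : ℂ)).coeFn_toL1
  -- (V9) for the constant function `h = 1`, applied to `f = 0`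
  have := V.var_comp 1 (fun _ => 1) 0 0 _ one_pos contDiffOn_const (by simp)
    ((Lp.coeFn_zero ℂ 1 μ).mono fun _ _ => by simp) hone
  simpa using this

instance : One V.Space := ⟨Space.mk _ (V.var_toL1_one.trans_lt ENNReal.zero_lt_top)⟩

theorem Space.val_one_ae_eq : (1 : V.Space).val =ᵐ[μ] fun _ => (1 : ℂ) :=
  (integrable_const (1 : ℂ)).coeFn_toL1

theorem Space.norm_one : ‖(1 : V.Space)‖ = 1 := by
  have hval : (1 : V.Space).val = (integrable_const (1 : ℂ)).toL1 _ := rfl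
  rw [norm_def, hval, var_toL1_one, L1.norm_of_fun_eq_integral_norm]
  simp

end One

/-- The integral as a functional on `𝓑`. -/
def intCLM (V : Variation μ C) : V.Space →L[ℂ] ℂ :=
  LinearMap.mkContinuous
    { toFun := fun φ => ∫ x, φ.val x ∂μ
      map_add' := fun φ ψ => by
        rw [Space.val_add, integral_congr_ae (Lp.coeFn_add φ.val ψ.val)]
        exact integral_add (L1.integrable_coeFn _) (L1.integrable_coeFn _)
      map_smul' := fun c φ => by
        rw [Space.val_smul, integral_congr_ae (Lp.coeFn_smul c φ.val)]
        exact integral_smul c _ }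
    1 fun φ => by
      rw [one_mul]
      refine (norm_integral_le_integral_norm _).trans ?_
      rw [← L1.norm_eq_integral_norm]
      exact φ.norm_val_le

theorem intCLM_apply (φ : V.Space) : V.intCLM φ = ∫ x, φ.val x ∂μ := rfl

theorem norm_intCLM_apply_le (φ : V.Space) : ‖V.intCLM φ‖ ≤ ‖φ.val‖ :=
  (norm_integral_le_integral_norm _).trans_eq (L1.norm_eq_integral_norm φ.val).symm

theorem norm_intCLM_le : ‖V.intCLM‖ ≤ 1 := LinearMap.mkContinuous_norm_le _ zero_le_one _

theorem intCLM_one [IsProbabilityMeasure μ] : V.intCLM 1 = 1 := by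
  rw [intCLM_apply, integral_congr_ae Space.val_one_ae_eq]
  simp

end Variation

theorem measurable_sect {Ω X E : Type*} [MeasurableSpace Ω] [MeasurableSpace X] [MeasurableSpace E]
    {𝒳 : Set (Ω × X)} {g : 𝒳 → E} (hg : Measurable g) (ω : Ω) : Measurable (sect g ω) :=
  hg.comp ((measurable_const.prodMk measurable_subtype_coe).subtype_mk)

namespace RandomSystem

variable {Ω X : Type*} [MeasurableSpace Ω] {ℙ : Measure Ω} [MetricSpace X] [MeasurableSpace X]
  (S : RandomSystem Ω X ℙ)

instance (ω : Ω) : IsProbabilityMeasure (S.m ω) := S.isProbabilityMeasure ω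

theorem measurable_fiberMap (ω : Ω) : Measurable (S.T ω) :=
  Measurable.subtype_mk (f := fun x => (S.T ω x : X)) (measurable_sect S.measurable_T ω)

theorem measurable_base : Measurable fun p : S.𝒳 => p.1.1 :=
  measurable_fst.comp measurable_subtype_coe

/-- The fiber measures `m_ω`, as a Markov kernel from `Ω` to `𝒳`. -/
def fiberKernel : ProbabilityTheory.Kernel Ω S.𝒳 where
  toFun ω := (S.m ω).map (sect id ω)
  measurable' := Measure.measurable_of_measurable_coe _ fun A hA => by
    have hind := (S.measurable_m (A.indicator 1) (measurable_one.indicator hA)).ennreal_ofReal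
    refine (congrArg Measurable (funext fun ω => ?_)).mp hind
    have hsect : MeasurableSet (sect id ω ⁻¹' A) := measurable_sect measurable_id ω hA
    rw [Measure.map_apply (measurable_sect measurable_id ω) hA]
    exact (congrArg _ (integral_indicator_one hsect)).trans
      (ofReal_measureReal (measure_ne_top _ _))

instance : ProbabilityTheory.IsMarkovKernel S.fiberKernel :=
  ⟨fun ω => Measure.isProbabilityMeasure_map (measurable_sect measurable_id ω).aemeasurable⟩

theorem fiberKernel_apply (ω : Ω) : S.fiberKernel ω = (S.m ω).map (sect id ω) := rfl

theorem setLIntegral_fiberKernel {g : S.𝒳 → ℝ≥0∞} (hg : Measurable g) {A : Set S.𝒳}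
    (hA : MeasurableSet A) (ω : Ω) :
    ∫⁻ p in A, g p ∂(S.fiberKernel ω) = ∫⁻ x in sect id ω ⁻¹' A, sect g ω x ∂(S.m ω) :=
  setLIntegral_map hA hg (measurable_sect measurable_id ω)

theorem measurable_integral_sect {g : S.𝒳 → ℂ} (hg : Measurable g) :
    Measurable fun ω => ∫ x, sect g ω x ∂(S.m ω) :=
  (congrArg Measurable (funext fun ω => integral_map
    (measurable_sect measurable_id ω).aemeasurable hg.aestronglyMeasurable)).mp
      (hg.stronglyMeasurable.integral_kernel (κ := S.fiberKernel)).measurable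

/-- The push-forwards `(T_ω)_* (g(ω, ·) m_ω)` of densities `g(ω, ·)`, as a kernel from `Ω` to
`X`. -/
def pushKernel (g : S.𝒳 → ℝ≥0∞) : ProbabilityTheory.Kernel Ω X :=
  (S.fiberKernel.withDensity fun _ => g).map fun p => (S.T p.1.1 ⟨p.1.2, p.2⟩ : X)

theorem pushKernel_apply {g : S.𝒳 → ℝ≥0∞} (hg : Measurable g) (ω : Ω) {t : Set X}
    (ht : MeasurableSet t) :
    S.pushKernel g ω t = ∫⁻ x in S.T ω ⁻¹' (Subtype.val ⁻¹' t), sect g ω x ∂(S.m ω) := by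
  rw [pushKernel, ProbabilityTheory.Kernel.map_apply' _ S.measurable_T _ ht,
    ProbabilityTheory.Kernel.withDensity_apply' (f := fun _ => g) _ (hg.comp measurable_snd)]
  exact S.setLIntegral_fiberKernel hg (S.measurable_T ht) ω

/-- The measures `m_{σω}`, as a kernel from `Ω` to `X`. -/
def nextKernel : ProbabilityTheory.Kernel Ω X :=
  (S.fiberKernel.comap S.σ S.σ.measurable).map fun p => p.1.2

instance : ProbabilityTheory.IsFiniteKernel S.nextKernel := by
  unfold nextKernel; infer_instance

theorem nextKernel_apply (ω : Ω) : S.nextKernel ω = (S.m (S.σ ω)).map Subtype.val := by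
  have hsnd : Measurable fun p : S.𝒳 => p.1.2 := measurable_snd.comp measurable_subtype_coe
  rw [nextKernel, ProbabilityTheory.Kernel.map_apply _ hsnd,
    ProbabilityTheory.Kernel.comap_apply, fiberKernel_apply,
    Measure.map_map hsnd (measurable_sect measurable_id _)]
  rfl

theorem pushKernel_absolutelyContinuous {g : S.𝒳 → ℝ≥0∞} (hg : Measurable g) (ω : Ω) :
    S.pushKernel g ω ≪ S.nextKernel ω := by
  refine Measure.AbsolutelyContinuous.mk fun t ht h => ?_
  rw [nextKernel_apply, Measure.map_apply measurable_subtype_coe ht] at h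
  have hnull := S.nonsingular ω h
  rw [Measure.map_apply (S.measurable_fiberMap ω) (measurable_subtype_coe ht)] at hnull
  rw [S.pushKernel_apply hg ω ht]
  exact setLIntegral_measure_zero _ _ hnull

theorem exists_measurable_setLIntegral_eq_preimage [MeasurableSpace.CountablyGenerated X]
    {g : S.𝒳 → ℝ≥0∞} (hg : Measurable g) (hg1 : ∀ ω, ∫⁻ x, sect g ω x ∂(S.m ω) ≤ 1) :
    ∃ G : S.𝒳 → ℝ≥0∞, Measurable G ∧ ∀ ω s, MeasurableSet s →
      ∫⁻ y in s, sect G (S.σ ω) y ∂(S.m (S.σ ω)) = ∫⁻ x in S.T ω ⁻¹' s, sect g ω x ∂(S.m ω) := by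
  have : ProbabilityTheory.IsFiniteKernel (S.pushKernel g) := ⟨1, ENNReal.one_lt_top, fun ω => by
    simpa only [S.pushKernel_apply hg ω MeasurableSet.univ, Set.preimage_univ,
      Measure.restrict_univ] using hg1 ω⟩
  let ρ := (S.pushKernel g).rnDeriv S.nextKernel
  have hρ : Measurable fun p : Ω × X => ρ p.1 p.2 :=
    ProbabilityTheory.Kernel.measurable_rnDeriv _ _
  have hbase : Measurable fun p : S.𝒳 => S.σ.symm p.1.1 :=
    S.σ.symm.measurable.comp S.measurable_base
  refine ⟨fun p => ρ (S.σ.symm p.1.1) p.1.2,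
    hρ.comp (hbase.prodMk (measurable_snd.comp measurable_subtype_coe)), ?_⟩
  rintro ω _ ⟨t, ht, rfl⟩
  have hG : sect (fun p : S.𝒳 => ρ (S.σ.symm p.1.1) p.1.2) (S.σ ω) =
      fun y : fiber S.𝒳 (S.σ ω) => ρ ω (y : X) := by
    funext y
    simp only [sect, MeasurableEquiv.symm_apply_apply]
  rw [hG, ← S.pushKernel_apply hg ω ht,
    ← ProbabilityTheory.Kernel.setLIntegral_rnDeriv (S.pushKernel_absolutelyContinuous hg ω) ht,
    nextKernel_apply]
  exact (setLIntegral_map ht (hρ.comp measurable_prodMk_left) measurable_subtype_coe).symm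

/-- The transfer operators have a jointly measurable version on the sections of the fiberwise
integrable function `g`, without exceptional fibers. -/
def HasMeasurableTransfer (g : S.𝒳 → ℂ) : Prop :=
  (∀ ω, Integrable (sect g ω) (S.m ω)) ∧ ∃ G : S.𝒳 → ℂ, Measurable G ∧ ∀ ω,
    transferL1 (S.T ω) (S.m ω) (S.m (S.σ ω)) (sect g ω) =ᵐ[S.m (S.σ ω)] sect G (S.σ ω)

namespace HasMeasurableTransfer

variable {S}

theorem add {g h : S.𝒳 → ℂ} (hg : S.HasMeasurableTransfer g) (hh : S.HasMeasurableTransfer h) :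
    S.HasMeasurableTransfer (g + h) := by
  obtain ⟨hgi, G, hG, hG'⟩ := hg
  obtain ⟨hhi, H, hH, hH'⟩ := hh
  refine ⟨fun ω => (hgi ω).add (hhi ω), G + H, hG.add hH, fun ω => ?_⟩
  have hadd := transferL1_add (S.measurable_fiberMap ω) (S.nonsingular ω) (hgi ω) (hhi ω)
  rw [show sect (g + h) ω = sect g ω + sect h ω from rfl, hadd]
  filter_upwards [hG' ω, hH' ω, Lp.coeFn_add (transferL1 (S.T ω) (S.m ω) (S.m (S.σ ω)) (sect g ω))
    (transferL1 (S.T ω) (S.m ω) (S.m (S.σ ω)) (sect h ω))] with y hGy hHy hy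
  rw [hy, Pi.add_apply, hGy, hHy]
  rfl

theorem base_mul {g : S.𝒳 → ℂ} (hg : S.HasMeasurableTransfer g) {a : Ω → ℂ} (ha : Measurable a) :
    S.HasMeasurableTransfer fun p => a p.1.1 * g p := by
  obtain ⟨hgi, G, hG, hG'⟩ := hg
  refine ⟨fun ω => (hgi ω).const_mul (a ω), fun p => a (S.σ.symm p.1.1) * G p,
    (ha.comp (S.σ.symm.measurable.comp S.measurable_base)).mul hG, fun ω => ?_⟩
  have hsmul := transferL1_smul (S.measurable_fiberMap ω) (S.nonsingular ω) (a ω) (hgi ω)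
  rw [show sect (fun p => a p.1.1 * g p) ω = a ω • sect g ω from rfl, hsmul]
  filter_upwards [hG' ω, Lp.coeFn_smul (a ω)
    (transferL1 (S.T ω) (S.m ω) (S.m (S.σ ω)) (sect g ω))] with y hGy hy
  rw [hy, Pi.smul_apply, hGy, smul_eq_mul]
  simp only [sect, MeasurableEquiv.symm_apply_apply]

theorem of_nonneg [MeasurableSpace.CountablyGenerated X] {g : S.𝒳 → ℝ} (hg : Measurable g)
    (hg0 : ∀ p, 0 ≤ g p) (hgi : ∀ ω, Integrable (sect g ω) (S.m ω))
    (hg1 : ∀ ω, ∫ x, sect g ω x ∂(S.m ω) ≤ 1) : S.HasMeasurableTransfer fun p => (g p : ℂ) := by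
  have hlintegral : ∀ ω s, ∫⁻ x in s, sect (fun p => ENNReal.ofReal (g p)) ω x ∂(S.m ω) =
      ENNReal.ofReal (∫ x in s, sect g ω x ∂(S.m ω)) := fun ω s =>
    (ofReal_integral_eq_lintegral_ofReal (hgi ω).integrableOn (ae_of_all _ fun _ => hg0 _)).symm
  obtain ⟨G, hG, hG'⟩ := S.exists_measurable_setLIntegral_eq_preimage hg.ennreal_ofReal fun ω => by
    simpa only [Measure.restrict_univ, hlintegral, ENNReal.ofReal_le_one]
      using (hlintegral ω Set.univ).le.trans (ENNReal.ofReal_le_one.2 (by simpa using hg1 ω))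
  have hGω : ∀ ω, Measurable (sect G ω) := measurable_sect hG
  have hfin : ∀ ω s, MeasurableSet s → ∫⁻ y in s, sect G (S.σ ω) y ∂(S.m (S.σ ω)) ≠ ∞ :=
    fun ω s hs => by rw [hG' ω s hs, hlintegral]; exact ENNReal.ofReal_ne_top
  have hGi : ∀ ω, Integrable (fun y => (sect G (S.σ ω) y).toReal) (S.m (S.σ ω)) := fun ω =>
    integrable_toReal_of_lintegral_ne_top (hGω _).aemeasurable
      (by simpa only [Measure.restrict_univ] using hfin ω Set.univ MeasurableSet.univ)
  refine ⟨fun ω => (hgi ω).ofReal, fun p => ((G p).toReal : ℂ),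
    Complex.measurable_ofReal.comp hG.ennreal_toReal, fun ω =>
      transferL1_ae_eq (S.measurable_fiberMap ω) (S.nonsingular ω) (hgi ω).ofReal (hGi ω).ofReal
        fun s hs => ?_⟩
  have hcast : ∀ y, sect (fun p => ((G p).toReal : ℂ)) (S.σ ω) y =
      ((sect G (S.σ ω) y).toReal : ℂ) := fun _ => rfl
  simp only [hcast]
  rw [integral_complex_ofReal, integral_toReal (hGω _).aemeasurable
    (ae_lt_top (hGω _) (hfin ω s hs)), hG' ω s hs, hlintegral,
    ENNReal.toReal_ofReal (integral_nonneg (f := sect g ω) fun _ => hg0 _)]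
  exact integral_complex_ofReal.symm

theorem of_real [MeasurableSpace.CountablyGenerated X] {g : S.𝒳 → ℝ} (hg : Measurable g)
    (hgi : ∀ ω, Integrable (sect g ω) (S.m ω)) (hg1 : ∀ ω, ∫ x, |sect g ω x| ∂(S.m ω) ≤ 1) :
    S.HasMeasurableTransfer fun p => (g p : ℂ) := by
  have hpart : ∀ h : S.𝒳 → ℝ, Measurable h → (∀ p, 0 ≤ h p) → (∀ p, h p ≤ |g p|) →
      S.HasMeasurableTransfer fun p => (h p : ℂ) := fun h hh hh0 hhg => by
    have hhi : ∀ ω, Integrable (sect h ω) (S.m ω) := fun ω =>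
      (hgi ω).mono (measurable_sect hh ω).aestronglyMeasurable
        (ae_of_all _ fun x => (abs_of_nonneg (hh0 _)).trans_le (hhg _))
    exact of_nonneg hh hh0 hhi fun ω =>
      (integral_mono (hhi ω) (hgi ω).abs fun x => hhg _).trans (hg1 ω)
  have hpos := hpart (fun p => (g p)⁺) hg.posPart (fun p => posPart_nonneg _)
    fun p => sup_le (le_abs_self _) (abs_nonneg _)
  have hneg := hpart (fun p => (g p)⁻) hg.negPart (fun p => negPart_nonneg _)
    fun p => sup_le (neg_le_abs _) (abs_nonneg _)
  convert hpos.add (hneg.base_mul (measurable_const (a := (-1 : ℂ)))) using 2 with p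
  rw [Pi.add_apply, neg_one_mul, ← sub_eq_add_neg, ← Complex.ofReal_sub, posPart_sub_negPart]

theorem of_measurable [MeasurableSpace.CountablyGenerated X] {g : S.𝒳 → ℂ} (hg : Measurable g)
    (hgi : ∀ ω, Integrable (sect g ω) (S.m ω)) : S.HasMeasurableTransfer g := by
  let a : Ω → ℝ := fun ω => 1 + ‖∫ x, sect (fun p => (‖g p‖ : ℂ)) ω x ∂(S.m ω)‖
  have ha : Measurable a := measurable_const.add (S.measurable_integral_sect
    (Complex.measurable_ofReal.comp hg.norm)).norm
  have ha0 : ∀ ω, 0 < a ω := fun ω => by positivity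
  have hga : ∀ ω, ∫ x, ‖sect g ω x‖ ∂(S.m ω) ≤ a ω := fun ω => by
    refine (le_abs_self _).trans ?_
    rw [← Real.norm_eq_abs, ← Complex.norm_real, ← integral_complex_ofReal]
    exact le_add_of_nonneg_left zero_le_one
  have hpart : ∀ L : ℂ → ℝ, Measurable L → (∀ z, |L z| ≤ ‖z‖) →
      S.HasMeasurableTransfer fun p => (((a p.1.1)⁻¹ * L (g p) : ℝ) : ℂ) := fun L hL hLz => by
    have hLi : ∀ ω, Integrable (fun x => L (sect g ω x)) (S.m ω) := fun ω =>
      (hgi ω).mono (hL.comp (measurable_sect hg ω)).aestronglyMeasurable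
        (ae_of_all _ fun x => hLz _)
    refine of_real ((ha.comp S.measurable_base).inv.mul (hL.comp hg))
      (fun ω => (hLi ω).const_mul (a ω)⁻¹) fun ω => ?_
    change ∫ x, |(a ω)⁻¹ * L (sect g ω x)| ∂(S.m ω) ≤ 1
    simp only [abs_mul, abs_of_pos (inv_pos.2 (ha0 ω)), integral_const_mul]
    rw [inv_mul_le_iff₀ (ha0 ω), mul_one]
    exact (integral_mono (hLi ω).abs (hgi ω).norm fun x => hLz _).trans (hga ω)
  have hre := hpart Complex.re Complex.measurable_re Complex.abs_re_le_norm
  have him := hpart Complex.im Complex.measurable_im Complex.abs_im_le_norm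
  convert (hre.add (him.base_mul (measurable_const (a := Complex.I)))).base_mul
    (Complex.measurable_ofReal.comp ha) using 2 with p
  have hap : (a p.1.1 : ℂ) ≠ 0 := Complex.ofReal_ne_zero.2 (ha0 _).ne'
  simp only [Pi.add_apply, Function.comp_apply, Complex.ofReal_mul, Complex.ofReal_inv]
  rw [mul_left_comm, ← mul_add, mul_inv_cancel_left₀ hap, mul_comm Complex.I]
  exact (Complex.re_add_im (g p)).symm

end HasMeasurableTransfer

end RandomSystem

section BanachAlgebra

variable {A : Type*} [NormedRing A] [NormedAlgebra ℂ A] [CompleteSpace A]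

theorem norm_exp_sub_one_le_exp_norm_sub_one (a : A) :
    ‖NormedSpace.exp a - 1‖ ≤ Real.exp ‖a‖ - 1 := by
  have hexp := (hasSum_nat_add_iff' 1).2 (NormedSpace.exp_series_hasSum_exp' (𝕂 := ℂ) a)
  have hreal := (hasSum_nat_add_iff' 1).2 (NormedSpace.exp_series_hasSum_exp' (𝕂 := ℝ) ‖a‖)
  simp only [Finset.sum_range_one, Nat.factorial_zero, Nat.cast_one, inv_one, pow_zero, one_smul]
    at hexp hreal
  rw [← Real.exp_eq_exp_ℝ] at hreal
  rw [← hexp.tsum_eq]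
  refine tsum_of_norm_bounded hreal fun n => ?_
  rw [norm_smul, smul_eq_mul, norm_inv, Complex.norm_natCast]
  gcongr
  exact norm_pow_le' a n.succ_pos

theorem differentiable_exp_smul (a : A) :
    Differentiable ℂ fun θ : ℂ => NormedSpace.exp (θ • a) := fun θ =>
  (hasDerivAt_exp_smul_const a θ).differentiableAt

end BanachAlgebra

section BanachSpace

variable {E G : Type*} [NormedAddCommGroup E] [NormedSpace ℂ E] [CompleteSpace E]
  [NormedAddCommGroup G] [NormedSpace ℂ G] [CompleteSpace G]

theorem map_exp_apply_of_intertwining (J : E →L[ℂ] G) {a : E →L[ℂ] E} {b : G →L[ℂ] G}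
    (h : ∀ x, J (a x) = b (J x)) (x : E) :
    J (NormedSpace.exp a x) = NormedSpace.exp b (J x) := by
  have hpow : ∀ n, J ((a ^ n) x) = (b ^ n) (J x) := fun n => by
    simpa only [FunLike.coe_pow_eq_iterate] using Function.Semiconj.iterate_right h n x
  have hleft := (J.comp (ContinuousLinearMap.apply ℂ E x)).hasSum
    (NormedSpace.exp_series_hasSum_exp' (𝕂 := ℂ) a)
  have hright := (ContinuousLinearMap.apply ℂ G (J x)).hasSum
    (NormedSpace.exp_series_hasSum_exp' (𝕂 := ℂ) b)
  refine hleft.unique (hright.congr_fun fun n => ?_)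
  change J ((n.factorial : ℂ)⁻¹ • (a ^ n) x) = (n.factorial : ℂ)⁻¹ • (b ^ n) (J x)
  rw [map_smul, hpow]

theorem exists_mem_map_eq_self_of_norm_pow_le {L : E →L[ℂ] E} {s : Set E} (hs : IsClosed s)
    (hL : Set.MapsTo L s s) {e : E} (he : e ∈ s) {C r : ℝ} (hr : r < 1)
    (h : ∀ n, ‖(L ^ n) (e - L e)‖ ≤ C * r ^ n) : ∃ v ∈ s, L v = v := by
  have hdist : ∀ n, dist (L^[n] e) (L^[n + 1] e) ≤ C * r ^ n := fun n => by
    rw [Function.iterate_succ_apply, dist_eq_norm, ← FunLike.coe_pow_eq_iterate, ← map_sub]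
    exact h n
  obtain ⟨v, hv⟩ := cauchySeq_tendsto_of_complete (cauchySeq_of_le_geometric _ _ hr hdist)
  exact ⟨v, hs.mem_of_tendsto hv (Eventually.of_forall fun n => hL.iterate n he),
    isFixedPt_of_tendsto_iterate hv L.continuous.continuousAt⟩

theorem isUnit_one_sub_of_norm_pow_le_on_ker {L P : E →L[ℂ] E} (hP : IsIdempotentElem P)
    (hPL : Commute P L) {D r : ℝ} (hD : 0 ≤ D) (hr0 : 0 ≤ r) (hr : r < 1)
    (h : ∀ n w, P w = 0 → ‖(L ^ n) w‖ ≤ D * r ^ n * ‖w‖) : IsUnit (1 - (L - P * L)) := by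
  have hN : L - P * L = (1 - P) * L := by rw [sub_mul, one_mul]
  have hcomm : Commute (1 - P) L := (Commute.one_left L).sub_left hPL
  have hpow : ∀ n, ‖(L - P * L) ^ (n + 1)‖ ≤ D * r ^ (n + 1) * ‖1 - P‖ := fun n => by
    rw [hN, hcomm.mul_pow, hP.one_sub.pow_succ_eq, (hcomm.pow_right _).eq]
    refine ContinuousLinearMap.opNorm_le_bound _ (by positivity) fun w => ?_
    have hPw : P ((1 - P) w) = 0 := by
      change (P * (1 - P)) w = 0
      rw [mul_sub, mul_one, hP.eq, sub_self]; rfl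
    calc ‖(L ^ (n + 1)) ((1 - P) w)‖ ≤ D * r ^ (n + 1) * ‖(1 - P) w‖ := h (n + 1) _ hPw
      _ ≤ D * r ^ (n + 1) * (‖1 - P‖ * ‖w‖) := by gcongr; exact (1 - P).le_opNorm w
      _ = D * r ^ (n + 1) * ‖1 - P‖ * ‖w‖ := (mul_assoc _ _ _).symm
  have hlim : Tendsto (fun n : ℕ => D * r ^ (n + 1) * ‖1 - P‖) atTop (𝓝 0) := by
    simpa using (((tendsto_pow_atTop_nhds_zero_of_lt_one hr0 hr).comp
      (tendsto_add_atTop_nat 1)).const_mul D).mul_const ‖1 - P‖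
  obtain ⟨n, hn⟩ := (hlim.eventually_lt_const one_pos).exists
  have hunit := isUnit_one_sub_of_norm_lt_one ((hpow n).trans_lt hn)
  rw [← mul_neg_geom_sum] at hunit
  have hgeom : Commute (1 - (L - P * L)) (∑ i ∈ Finset.range (n + 1), (L - P * L) ^ i) :=
    (Commute.one_left _).sub_left (Commute.sum_right _ _ _ fun i _ => (Commute.refl _).pow_right i)
  exact (hgeom.isUnit_mul_iff.1 hunit).1

/-- The equation `A θ w = b (A θ w) w`, as a function of `(θ, w)`: its zeros are eigenvectors `w`
of `A θ`, the bilinear map `b` playing the role of the multiplication of `w` by an eigenvalue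
which depends linearly on `A θ w`. -/
def eigenvectorDefect (A : ℂ → E →L[ℂ] E) (b : E →L[ℂ] E →L[ℂ] E) (p : ℂ × E) : E :=
  A p.1 p.2 - b (A p.1 p.2) p.2

theorem contDiffAt_eigenvectorDefect {A : ℂ → E →L[ℂ] E} {θ : ℂ} (hA : AnalyticAt ℂ A θ)
    (b : E →L[ℂ] E →L[ℂ] E) (v : E) : ContDiffAt ℂ ⊤ (eigenvectorDefect A b) (θ, v) := by
  have happly : ContDiffAt ℂ ⊤ (fun p : ℂ × E => A p.1 p.2) (θ, v) :=
    (ContDiffAt.comp (θ, v) (g := A) hA.contDiffAt contDiffAt_fst).clm_apply contDiffAt_snd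
  exact happly.sub ((b.contDiff.contDiffAt.comp _ happly).clm_apply contDiffAt_snd)

theorem fderiv_eigenvectorDefect_comp_inr {A : ℂ → E →L[ℂ] E} {θ : ℂ} (hA : AnalyticAt ℂ A θ)
    {b : E →L[ℂ] E →L[ℂ] E} {v : E} (hv : A θ v = v) (hb : ∀ w, b v w = w) :
    fderiv ℂ (eigenvectorDefect A b) (θ, v) ∘L .inr ℂ ℂ E = -(1 - (A θ - b.flip v * A θ)) := by
  have hpartial : HasFDerivAt (fun w => eigenvectorDefect A b (θ, w))
      (fderiv ℂ (eigenvectorDefect A b) (θ, v) ∘L .inr ℂ ℂ E) v :=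
    ((contDiffAt_eigenvectorDefect hA b v).differentiableAt (by simp)).hasFDerivAt.comp v
      (hasFDerivAt_prodMk_right θ v)
  have hdirect : HasFDerivAt (fun w => eigenvectorDefect A b (θ, w))
      (A θ - ((b (A θ v)).comp (.id ℂ E) + (b.comp (A θ)).flip v)) v :=
    (A θ).hasFDerivAt.sub ((b.comp (A θ)).hasFDerivAt.clm_apply (hasFDerivAt_id v))
  rw [hpartial.unique hdirect]
  ext w
  simp only [sub_apply, add_apply, neg_apply, ContinuousLinearMap.comp_apply,
    ContinuousLinearMap.flip_apply, ContinuousLinearMap.id_apply, hv, hb]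
  abel

theorem exists_analytic_eigenvector {A : ℂ → E →L[ℂ] E} {θ₀ : ℂ} (hA : AnalyticAt ℂ A θ₀)
    {b : E →L[ℂ] E →L[ℂ] E} {v : E} (hv : A θ₀ v = v) (hb : ∀ w, b v w = w)
    (hunit : IsUnit (1 - (A θ₀ - b.flip v * A θ₀))) :
    ∃ u : ℂ → E, u θ₀ = v ∧ AnalyticAt ℂ u θ₀ ∧
      ∀ᶠ θ in 𝓝 θ₀, A θ (u θ) = b (A θ (u θ)) (u θ) := by
  have hdiff := contDiffAt_eigenvectorDefect hA b v
  have hinv : (fderiv ℂ (eigenvectorDefect A b) (θ₀, v) ∘L .inr ℂ ℂ E).IsInvertible := by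
    rw [fderiv_eigenvectorDefect_comp_inr hA hv hb]
    obtain ⟨e, he⟩ := hunit.neg
    exact ⟨ContinuousLinearEquiv.unitsEquiv ℂ E e, he⟩
  have hzero : eigenvectorDefect A b (θ₀, v) = 0 := by
    simp only [eigenvectorDefect, hv, hb, sub_self]
  refine ⟨hdiff.implicitFunction (by simp) hinv, hdiff.implicitFunction_apply_self _ hinv,
    (hdiff.contDiffAt_implicitFunction _ hinv).analyticAt, ?_⟩
  filter_upwards [hdiff.eventually_apply_implicitFunction (by simp) hinv] with θ hθ
  exact sub_eq_zero.1 (hθ.trans hzero)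

end BanachSpace

section Cocycle

variable {I : Type*} {σ : I → I} {E : I → Type*} [∀ i, NormedAddCommGroup (E i)]
  [∀ i, NormedSpace ℂ (E i)]

/-- The iterates `A_{σ^{n-1} i} ∘ ⋯ ∘ A_{σ i} ∘ A_i` of a family of operators `A_i : E_i → E_{σ i}`,
for arbitrary fibers `E_i` over an arbitrary map `σ`. -/
def cocycleIter (A : ∀ i, E i →L[ℂ] E (σ i)) : (n : ℕ) → (i : I) → E i →L[ℂ] E (σ^[n] i)
  | 0, i => .id ℂ (E i)
  | n + 1, i => (cocycleIter A n (σ i)).comp (A i)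

theorem cocycleIter_succ_apply (A : ∀ i, E i →L[ℂ] E (σ i)) (n : ℕ) (i : I) (h : E i) :
    cocycleIter A (n + 1) i h = cocycleIter A n (σ i) (A i h) := rfl

theorem cocycleIter_smul (A : ∀ i, E i →L[ℂ] E (σ i)) (l : I → ℂ) (n : ℕ) (i : I) :
    cocycleIter (fun i => l i • A i) n i =
      (∏ k ∈ Finset.range n, l (σ^[k] i)) • cocycleIter A n i := by
  induction n generalizing i with
  | zero => rw [Finset.prod_range_zero]; exact (one_smul ℂ _).symm
  | succ n ih =>
    rw [cocycleIter, ih, Finset.prod_range_succ']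
    change ((∏ k ∈ Finset.range n, l (σ^[k] (σ i))) • cocycleIter A n (σ i)).comp (l i • A i) =
      ((∏ k ∈ Finset.range n, l (σ^[k] (σ i))) * l i) • (cocycleIter A n (σ i)).comp (A i)
    rw [ContinuousLinearMap.smul_comp, ContinuousLinearMap.comp_smul, smul_smul]

theorem differentiableOn_cocycleIter {U : Set ℂ} {A : ℂ → ∀ i, E i →L[ℂ] E (σ i)}
    (hA : ∀ i, DifferentiableOn ℂ (fun θ => A θ i) U) (n : ℕ) (i : I) :
    DifferentiableOn ℂ (fun θ => cocycleIter (A θ) n i) U := by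
  induction n generalizing i with
  | zero => exact differentiableOn_const _
  | succ n ih => exact (ih (σ i)).clm_comp (hA i)

theorem norm_cocycleIter_le_of_perturbation {L Q : ∀ i, E i →L[ℂ] E (σ i)}
    {p : ∀ i, Submodule ℂ (E i)} (hLp : ∀ i, ∀ h ∈ p i, L i h ∈ p (σ i))
    (hQp : ∀ i, ∀ h ∈ p i, Q i h ∈ p (σ i)) {D r ε : ℝ} (hD : 0 ≤ D) (hr : 0 ≤ r) (hε : 0 ≤ ε)
    (hL : ∀ n i, ∀ h ∈ p i, ‖cocycleIter L n i h‖ ≤ D * r ^ n * ‖h‖)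
    (hQL : ∀ i, ∀ h ∈ p i, ‖Q i h - L i h‖ ≤ ε * ‖h‖) (n : ℕ) {i : I} {h : E i} (hh : h ∈ p i) :
    ‖cocycleIter Q n i h‖ ≤ D * (r + D * ε) ^ n * ‖h‖ := by
  -- The constant `c` below does not deteriorate when `Q` is applied, whereas `D * ‖h‖` would.
  suffices hind : ∀ n i, ∀ h ∈ p i, ∀ c, (∀ k, ‖cocycleIter L k i h‖ ≤ c * r ^ k) →
      ‖cocycleIter Q n i h‖ ≤ c * (r + D * ε) ^ n from
    (hind n i h hh (D * ‖h‖) fun k => (hL k i h hh).trans_eq (by ring)).trans_eq (by ring)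
  intro n
  induction n with
  | zero => exact fun i h _ c hc => hc 0
  | succ n ih =>
    intro i h hh c hc
    rw [cocycleIter_succ_apply, pow_succ', ← mul_assoc]
    refine ih (σ i) _ (hQp i h hh) _ fun k => ?_
    have hsplit : Q i h = L i h + (Q i h - L i h) := by abel
    have hsub : ‖Q i h - L i h‖ ≤ ε * c :=
      (hQL i h hh).trans (mul_le_mul_of_nonneg_left ((hc 0).trans_eq (by ring)) hε)
    calc ‖cocycleIter L k (σ i) (Q i h)‖
        ≤ ‖cocycleIter L (k + 1) i h‖ + ‖cocycleIter L k (σ i) (Q i h - L i h)‖ := by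
          rw [hsplit, map_add, ← hsplit]; exact norm_add_le _ _
      _ ≤ c * r ^ (k + 1) + D * r ^ k * (ε * c) :=
          add_le_add (hc _) ((hL k _ _ (sub_mem (hQp i h hh) (hLp i h hh))).trans (by gcongr))
      _ = c * (r + D * ε) * r ^ k := by ring

/-- The part of the cocycle `M` transversal to the vectors `u`, for the projections `h ↦ μ(h) u`. -/
def transversal (μ : ∀ i, E i →L[ℂ] ℂ) (M : ∀ i, E i →L[ℂ] E (σ i)) (u : ∀ i, E i) (i : I) :
    E i →L[ℂ] E (σ i) :=
  M i - ((μ (σ i)).comp (M i)).smulRight (u (σ i))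

theorem transversal_apply (μ : ∀ i, E i →L[ℂ] ℂ) (M : ∀ i, E i →L[ℂ] E (σ i)) (u : ∀ i, E i) (i : I)
    (h : E i) : transversal μ M u i h = M i h - μ (σ i) (M i h) • u (σ i) := rfl

theorem norm_sub_functional_smul_le {V : Type*} [NormedAddCommGroup V] [NormedSpace ℂ V]
    {μ : V →L[ℂ] ℂ} (hμ : ‖μ‖ ≤ 1) {u : V} {C : ℝ} (hu : ‖u‖ ≤ C) (h : V) :
    ‖h - μ h • u‖ ≤ (1 + C) * ‖h‖ :=
  calc ‖h - μ h • u‖ ≤ ‖h‖ + ‖μ h‖ * ‖u‖ := (norm_sub_le _ _).trans_eq (by rw [norm_smul])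
    _ ≤ ‖h‖ + ‖h‖ * C := by gcongr; exact (μ.le_of_opNorm_le hμ h).trans_eq (one_mul _)
    _ = (1 + C) * ‖h‖ := by ring

theorem norm_cocycleIter_transversal_le {μ : ∀ i, E i →L[ℂ] ℂ} {L M : ∀ i, E i →L[ℂ] E (σ i)}
    {u : ∀ i, E i} {C D r ε : ℝ} (hμ : ∀ i, ‖μ i‖ ≤ 1) (hμL : ∀ i h, μ (σ i) (L i h) = μ i h)
    (hμu : ∀ i, μ i (u i) = 1) (hu : ∀ i, ‖u i‖ ≤ C) (hC : 0 ≤ C) (hD : 0 ≤ D) (hr : 0 ≤ r)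
    (hε : 0 ≤ ε) (hL : ∀ n i h, μ i h = 0 → ‖cocycleIter L n i h‖ ≤ D * r ^ n * ‖h‖)
    (hML : ∀ i, ‖M i - L i‖ ≤ ε) (n : ℕ) {i : I} {h : E i} (hh : μ i h = 0) :
    ‖cocycleIter (transversal μ M u) n i h‖ ≤ D * (r + D * ((1 + C) * ε)) ^ n * ‖h‖ := by
  refine norm_cocycleIter_le_of_perturbation (p := fun i => (μ i).ker)
    (fun i h hh => (hμL i h).trans hh) (fun i h _ => ?_) hD hr (by positivity) hL
    (fun i h hh => ?_) n hh
  · change μ (σ i) (transversal μ M u i h) = 0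
    rw [transversal_apply, map_sub, map_smul, hμu, smul_eq_mul, mul_one, sub_self]
  · have hsub : transversal μ M u i h - L i h =
        (M i - L i) h - μ (σ i) ((M i - L i) h) • u (σ i) := by
      have h0 : μ i h = 0 := hh
      rw [transversal_apply, sub_apply, map_sub, hμL, h0, sub_zero]
      abel
    calc ‖transversal μ M u i h - L i h‖ ≤ (1 + C) * ‖(M i - L i) h‖ :=
          hsub ▸ norm_sub_functional_smul_le (hμ _) (hu _) _
      _ ≤ (1 + C) * (ε * ‖h‖) := by gcongr; exact (M i - L i).le_of_opNorm_le (hML i) h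
      _ = (1 + C) * ε * ‖h‖ := (mul_assoc _ _ _).symm

/-- The functionals `μ ∘ M^n`. -/
def pullback (μ : ∀ i, E i →L[ℂ] ℂ) (M : ∀ i, E i →L[ℂ] E (σ i)) (n : ℕ) (i : I) : E i →L[ℂ] ℂ :=
  (μ (σ^[n] i)).comp (cocycleIter M n i)

theorem pullback_succ (μ : ∀ i, E i →L[ℂ] ℂ) (M : ∀ i, E i →L[ℂ] E (σ i)) (n : ℕ) (i : I) :
    pullback μ M (n + 1) i = (pullback μ M n (σ i)).comp (M i) := rfl

theorem pullback_eq_self {μ : ∀ i, E i →L[ℂ] ℂ} {M : ∀ i, E i →L[ℂ] E (σ i)}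
    (hμM : ∀ i, (μ (σ i)).comp (M i) = μ i) (n : ℕ) (i : I) : pullback μ M n i = μ i := by
  induction n generalizing i with
  | zero => rfl
  | succ n ih => rw [pullback_succ, ih, hμM]

/-- The functionals `lim μ ∘ M^n`, invariant under the cocycle `M`. The limit exists in the presence
of a spectral gap, see `HasSpectralGap.tendsto_pullback`. -/
def dualFunctional (μ : ∀ i, E i →L[ℂ] ℂ) (M : ∀ i, E i →L[ℂ] E (σ i)) (i : I) : E i →L[ℂ] ℂ :=
  limUnder atTop fun n => pullback μ M n i

theorem dualFunctional_eq_self {μ : ∀ i, E i →L[ℂ] ℂ} {M : ∀ i, E i →L[ℂ] E (σ i)}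
    (hμM : ∀ i, (μ (σ i)).comp (M i) = μ i) (i : I) : dualFunctional μ M i = μ i :=
  Tendsto.limUnder_eq (tendsto_const_nhds.congr fun n => (pullback_eq_self hμM n i).symm)

/-- The cocycle `M` preserves the vectors `u`, normalized by `μ(u) = 1`, and contracts transversally
to them at the exponential rate `r`, with all constants bounded by `C`. -/
structure HasSpectralGap (μ : ∀ i, E i →L[ℂ] ℂ) (M : ∀ i, E i →L[ℂ] E (σ i)) (u : ∀ i, E i)
    (C r : ℝ) : Prop where
  norm_functional_le : ∀ i, ‖μ i‖ ≤ 1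
  functional_vec : ∀ i, μ i (u i) = 1
  map_vec : ∀ i, M i (u i) = u (σ i)
  norm_vec_le : ∀ i, ‖u i‖ ≤ C
  norm_map_le : ∀ i, ‖M i‖ ≤ C
  norm_transversal_le : ∀ n i h, μ i h = 0 →
    ‖cocycleIter (transversal μ M u) n i h‖ ≤ C * r ^ n * ‖h‖
  pos_const : 0 < C
  pos_rate : 0 < r
  rate_lt_one : r < 1

namespace HasSpectralGap

variable {μ : ∀ i, E i →L[ℂ] ℂ} {M : ∀ i, E i →L[ℂ] E (σ i)} {u : ∀ i, E i} {C r : ℝ}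

theorem transversal_sub_smul_vec (H : HasSpectralGap μ M u C r) (i : I) (c : ℂ) (h : E i) :
    transversal μ M u i (h - c • u i) = transversal μ M u i h := by
  have hvec : transversal μ M u i (u i) = 0 := by
    rw [transversal_apply, H.map_vec, H.functional_vec, one_smul, sub_self]
  rw [map_sub, map_smul, hvec, smul_zero, sub_zero]

theorem cocycleIter_eq (H : HasSpectralGap μ M u C r) (n : ℕ) (i : I) (h : E i) :
    cocycleIter M n i h = pullback μ M n i h • u (σ^[n] i) +
      cocycleIter (transversal μ M u) n i (h - μ i h • u i) := by
  induction n generalizing i with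
  | zero => exact (add_sub_cancel _ h).symm
  | succ n ih =>
    rw [cocycleIter_succ_apply, ih, cocycleIter_succ_apply, H.transversal_sub_smul_vec,
      ← transversal_apply]
    rfl

theorem norm_transversal_sub_le (H : HasSpectralGap μ M u C r) (n : ℕ) (i : I) (h : E i) :
    ‖cocycleIter (transversal μ M u) n i (h - μ i h • u i)‖ ≤ C * (1 + C) * r ^ n * ‖h‖ := by
  have hker : μ i (h - μ i h • u i) = 0 := by
    rw [map_sub, map_smul, H.functional_vec, smul_eq_mul, mul_one, sub_self]
  have hC := H.pos_const
  have hr := H.pos_rate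
  calc _ ≤ C * r ^ n * ‖h - μ i h • u i‖ := H.norm_transversal_le n i _ hker
    _ ≤ C * r ^ n * ((1 + C) * ‖h‖) := by
        gcongr; exact norm_sub_functional_smul_le (H.norm_functional_le i) (H.norm_vec_le i) h
    _ = C * (1 + C) * r ^ n * ‖h‖ := by ring

theorem pullback_vec (H : HasSpectralGap μ M u C r) (n : ℕ) (i : I) :
    pullback μ M n i (u i) = 1 := by
  induction n generalizing i with
  | zero => exact H.functional_vec i
  | succ n ih => rw [pullback_succ, ContinuousLinearMap.comp_apply, H.map_vec, ih]

theorem norm_pullback_succ_sub_apply_le (H : HasSpectralGap μ M u C r) (n : ℕ) (i : I) (h : E i) :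
    ‖pullback μ M (n + 1) i h - pullback μ M n i h‖ ≤
      C * ‖cocycleIter (transversal μ M u) n i (h - μ i h • u i)‖ := by
  induction n generalizing i with
  | zero =>
    have hsub : pullback μ M (0 + 1) i h - pullback μ M 0 i h =
        μ (σ i) (M i (h - μ i h • u i)) := by
      rw [map_sub, map_smul, H.map_vec, map_sub, map_smul, H.functional_vec, smul_eq_mul, mul_one]
      rfl
    rw [hsub]
    exact ((μ (σ i)).le_of_opNorm_le (H.norm_functional_le _) _).trans
      ((one_mul _).trans_le ((M i).le_of_opNorm_le (H.norm_map_le i) _))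
  | succ n ih =>
    rw [cocycleIter_succ_apply, H.transversal_sub_smul_vec]
    exact ih (σ i) (M i h)

theorem dist_pullback_succ_le (H : HasSpectralGap μ M u C r) (n : ℕ) (i : I) :
    dist (pullback μ M n i) (pullback μ M (n + 1) i) ≤ C ^ 2 * (1 + C) * r ^ n := by
  have hC := H.pos_const
  have hr := H.pos_rate
  rw [dist_comm, dist_eq_norm]
  refine ContinuousLinearMap.opNorm_le_bound _ (by positivity) fun h => ?_
  calc ‖(pullback μ M (n + 1) i - pullback μ M n i) h‖
      ≤ C * ‖cocycleIter (transversal μ M u) n i (h - μ i h • u i)‖ :=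
        H.norm_pullback_succ_sub_apply_le n i h
    _ ≤ C * (C * (1 + C) * r ^ n * ‖h‖) := by gcongr; exact H.norm_transversal_sub_le n i h
    _ = C ^ 2 * (1 + C) * r ^ n * ‖h‖ := by ring

theorem tendsto_pullback (H : HasSpectralGap μ M u C r) (i : I) :
    Tendsto (fun n => pullback μ M n i) atTop (𝓝 (dualFunctional μ M i)) :=
  tendsto_nhds_limUnder (cauchySeq_tendsto_of_complete
    (cauchySeq_of_le_geometric _ _ H.rate_lt_one fun n => H.dist_pullback_succ_le n i))

theorem dist_pullback_dualFunctional_le (H : HasSpectralGap μ M u C r) (n : ℕ) (i : I) :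
    dist (pullback μ M n i) (dualFunctional μ M i) ≤ C ^ 2 * (1 + C) / (1 - r) * r ^ n :=
  (dist_le_of_le_geometric_of_tendsto _ _ H.rate_lt_one (fun n => H.dist_pullback_succ_le n i)
    (H.tendsto_pullback i) n).trans_eq (div_mul_eq_mul_div _ _ _).symm

theorem tendsto_pullback_apply (H : HasSpectralGap μ M u C r) (i : I) (h : E i) :
    Tendsto (fun n => pullback μ M n i h) atTop (𝓝 (dualFunctional μ M i h)) :=
  ((ContinuousLinearMap.apply ℂ ℂ h).continuous.tendsto _).comp (H.tendsto_pullback i)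

theorem dualFunctional_comp (H : HasSpectralGap μ M u C r) (i : I) :
    (dualFunctional μ M (σ i)).comp (M i) = dualFunctional μ M i :=
  ContinuousLinearMap.ext fun h => tendsto_nhds_unique (H.tendsto_pullback_apply (σ i) (M i h))
    ((H.tendsto_pullback_apply i h).comp (tendsto_add_atTop_nat 1))

theorem dualFunctional_vec (H : HasSpectralGap μ M u C r) (i : I) :
    dualFunctional μ M i (u i) = 1 :=
  tendsto_nhds_unique (H.tendsto_pullback_apply i (u i))
    (tendsto_const_nhds.congr fun n => (H.pullback_vec n i).symm)

theorem norm_dualFunctional_le (H : HasSpectralGap μ M u C r) (i : I) :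
    ‖dualFunctional μ M i‖ ≤ 1 + C ^ 2 * (1 + C) / (1 - r) := by
  have hdist := H.dist_pullback_dualFunctional_le 0 i
  rw [pow_zero, mul_one, dist_eq_norm_sub'] at hdist
  exact (norm_le_norm_add_norm_sub' _ _).trans (add_le_add (H.norm_functional_le i) hdist)

theorem norm_cocycleIter_sub_le (H : HasSpectralGap μ M u C r) (n : ℕ) (i : I) (h : E i) :
    ‖cocycleIter M n i h - dualFunctional μ M i h • u (σ^[n] i)‖ ≤
      (C ^ 3 * (1 + C) / (1 - r) + C * (1 + C)) * r ^ n * ‖h‖ := by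
  have hC := H.pos_const
  have hr := H.pos_rate
  have hr1 : 0 < 1 - r := sub_pos.2 H.rate_lt_one
  have hsplit : cocycleIter M n i h - dualFunctional μ M i h • u (σ^[n] i) =
      (pullback μ M n i - dualFunctional μ M i) h • u (σ^[n] i) +
        cocycleIter (transversal μ M u) n i (h - μ i h • u i) := by
    rw [H.cocycleIter_eq, sub_apply, sub_smul]; abel
  have hfunctional := H.dist_pullback_dualFunctional_le n i
  rw [dist_eq_norm] at hfunctional
  calc _ ≤ ‖(pullback μ M n i - dualFunctional μ M i) h‖ * ‖u (σ^[n] i)‖ +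
          ‖cocycleIter (transversal μ M u) n i (h - μ i h • u i)‖ := by
        rw [hsplit, ← norm_smul]; exact norm_add_le _ _
    _ ≤ C ^ 2 * (1 + C) / (1 - r) * r ^ n * ‖h‖ * C + C * (1 + C) * r ^ n * ‖h‖ :=
        add_le_add (mul_le_mul (ContinuousLinearMap.le_of_opNorm_le _ hfunctional h)
          (H.norm_vec_le _) (norm_nonneg _) (by positivity)) (H.norm_transversal_sub_le n i h)
    _ = (C ^ 3 * (1 + C) / (1 - r) + C * (1 + C)) * r ^ n * ‖h‖ := by ring

end HasSpectralGap

theorem differentiableOn_dualFunctional {U : Set ℂ} (hU : IsOpen U) {μ : ∀ i, E i →L[ℂ] ℂ}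
    {M : ℂ → ∀ i, E i →L[ℂ] E (σ i)} {u : ℂ → ∀ i, E i} {C r : ℝ}
    (hM : ∀ i, DifferentiableOn ℂ (fun θ => M θ i) U)
    (H : ∀ θ ∈ U, HasSpectralGap μ (M θ) (u θ) C r) (i : I) :
    DifferentiableOn ℂ (fun θ => dualFunctional μ (M θ) i) U := by
  have hpullback : ∀ n, DifferentiableOn ℂ (fun θ => pullback μ (M θ) n i) U := fun n =>
    (differentiableOn_const _).clm_comp (differentiableOn_cocycleIter hM n i)
  have huniform : TendstoUniformlyOn (fun n θ => pullback μ (M θ) n i)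
      (fun θ => dualFunctional μ (M θ) i) atTop U := by
    obtain rfl | ⟨θ₀, hθ₀⟩ := U.eq_empty_or_nonempty
    · exact tendstoUniformlyOn_empty
    have hlim := (tendsto_pow_atTop_nhds_zero_of_lt_one (H θ₀ hθ₀).pos_rate.le
      (H θ₀ hθ₀).rate_lt_one).const_mul (C ^ 2 * (1 + C) / (1 - r))
    rw [mul_zero] at hlim
    refine Metric.tendstoUniformlyOn_iff.2 fun ε hε => ?_
    filter_upwards [hlim.eventually_lt_const hε] with n hn θ hθ
    rw [dist_comm]
    exact ((H θ hθ).dist_pullback_dualFunctional_le n i).trans_lt hn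
  exact huniform.tendstoLocallyUniformlyOn.differentiableOn (Eventually.of_forall hpullback) hU

end Cocycle

namespace RandomSystem

variable {Ω X : Type*} [MeasurableSpace Ω] {ℙ : Measure Ω} [MetricSpace X] [MeasurableSpace X]
  {S : RandomSystem Ω X ℙ}

namespace MeasurableVec

variable {w z : ∀ ω, S.B ω}

theorem add (hw : S.MeasurableVec w) (hz : S.MeasurableVec z) :
    S.MeasurableVec fun ω => w ω + z ω := by
  obtain ⟨g, hg, hgw⟩ := hw
  obtain ⟨h, hh, hhz⟩ := hz
  refine ⟨fun p => g p + h p, hg.add hh, fun ω => ?_⟩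
  exact (Lp.coeFn_add (w ω).val (z ω).val).trans ((hgw ω).add (hhz ω))

theorem smul (hw : S.MeasurableVec w) {a : Ω → ℂ} (ha : Measurable a) :
    S.MeasurableVec fun ω => a ω • w ω := by
  obtain ⟨g, hg, hgw⟩ := hw
  refine ⟨fun p => a p.1.1 * g p, (ha.comp S.measurable_base).mul hg, fun ω => ?_⟩
  exact (Lp.coeFn_smul (a ω) (w ω).val).trans ((hgw ω).const_smul (a ω))

theorem zero : S.MeasurableVec fun _ => 0 :=
  ⟨fun _ => 0, measurable_const, fun _ => Lp.coeFn_zero _ _ _⟩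

theorem one : S.MeasurableVec fun _ => 1 :=
  ⟨fun _ => 1, measurable_const, fun _ => Variation.Space.val_one_ae_eq⟩

theorem mulCLM (hw : S.MeasurableVec w) (hz : S.MeasurableVec z) :
    S.MeasurableVec fun ω => Variation.mulCLM (w ω) (z ω) := by
  obtain ⟨g, hg, hgw⟩ := hw
  obtain ⟨h, hh, hhz⟩ := hz
  refine ⟨fun p => g p * h p, hg.mul hh, fun ω => ?_⟩
  exact (Variation.mulCLM_ae_eq (w ω) (z ω)).trans ((hgw ω).mul (hhz ω))

theorem exp_mulCLM (θ : ℂ) (hw : S.MeasurableVec w) (hz : S.MeasurableVec z) :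
    S.MeasurableVec fun ω => NormedSpace.exp (θ • Variation.mulCLM (w ω)) (z ω) := by
  obtain ⟨g, hg, hgw⟩ := hw
  obtain ⟨h, hh, hhz⟩ := hz
  refine ⟨fun p => Complex.exp (θ * g p) * h p, (hg.const_mul θ).cexp.mul hh, fun ω => ?_⟩
  filter_upwards [Variation.exp_mulCLM_ae_eq (w ω) (z ω) θ, hgw ω, hhz ω] with x hx hgx hhx
  rw [hx, hgx, hhx]
  rfl

theorem of_tendsto {w : ℕ → ∀ ω, S.B ω} (hw : ∀ n, S.MeasurableVec (w n))
    (h : ∀ ω, Tendsto (fun n => w n ω) atTop (𝓝 (z ω))) : S.MeasurableVec z := by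
  choose g hg hgw using hw
  refine ⟨fun p => limUnder atTop fun n => g n p,
    (StronglyMeasurable.limUnder fun n => (hg n).stronglyMeasurable).measurable, fun ω => ?_⟩
  filter_upwards [Variation.Space.ae_tendsto (h ω), ae_all_iff.2 fun n => hgw n ω] with x hlim hx
  simp only [hx] at hlim
  exact hlim.limUnder_eq.symm

theorem measurable_intCLM (hw : S.MeasurableVec w) :
    Measurable fun ω => (S.V ω).intCLM (w ω) := by
  obtain ⟨g, hg, hgw⟩ := hw
  exact (congrArg Measurable (funext fun ω => integral_congr_ae (hgw ω))).mpr
    (S.measurable_integral_sect hg)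

end MeasurableVec

end RandomSystem

namespace RandomSystem

variable {Ω X : Type*} [MeasurableSpace Ω] {ℙ : Measure Ω} [MetricSpace X] [MeasurableSpace X]

/-- The bounded measurable families `(w_ω ∈ 𝓑_ω)_ω`, as a subspace of the `ℓ^∞`-sum of the
fibers. -/
def boundedFamilies (S : RandomSystem Ω X ℙ) : Submodule ℂ (lp S.B ∞) where
  carrier := {w | S.MeasurableVec w}
  zero_mem' := MeasurableVec.zero
  add_mem' := MeasurableVec.add
  smul_mem' c _ hw := hw.smul (measurable_const (a := c))

/-- The Banach space of bounded measurable families `(w_ω ∈ 𝓑_ω)_ω` with the supremum norm. Cocycles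
over `σ` act on it as single operators, which makes perturbation theory uniform in `ω`. -/
def BoundedFamily (S : RandomSystem Ω X ℙ) : Type _ := S.boundedFamilies

variable {S : RandomSystem Ω X ℙ}

namespace BoundedFamily

instance : NormedAddCommGroup S.BoundedFamily :=
  inferInstanceAs (NormedAddCommGroup S.boundedFamilies)

instance : NormedSpace ℂ S.BoundedFamily := inferInstanceAs (NormedSpace ℂ S.boundedFamilies)

instance : CompleteSpace S.BoundedFamily :=
  IsClosed.completeSpace_coe (hs := IsSeqClosed.isClosed fun _ w hw hlim =>
    MeasurableVec.of_tendsto hw fun ω =>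
      ((lp.evalCLM ℂ S.B ∞ ω).continuous.tendsto w).comp hlim)

/-- The evaluation `w ↦ w_ω` of families. -/
def eval (ω : Ω) : S.BoundedFamily →L[ℂ] S.B ω :=
  LinearMap.mkContinuous
    { toFun := fun w => w.1 ω, map_add' := fun _ _ => rfl, map_smul' := fun _ _ => rfl } 1
    fun w => (lp.norm_apply_le_norm ENNReal.top_ne_zero w.1 ω).trans_eq (one_mul _).symm

theorem measurableVec_eval (w : S.BoundedFamily) : S.MeasurableVec fun ω => eval ω w := w.2

theorem norm_eval_le (w : S.BoundedFamily) (ω : Ω) : ‖eval ω w‖ ≤ ‖w‖ :=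
  lp.norm_apply_le_norm ENNReal.top_ne_zero w.1 ω

theorem norm_le_of_forall_le {w : S.BoundedFamily} {C : ℝ} (hC : 0 ≤ C)
    (h : ∀ ω, ‖eval ω w‖ ≤ C) : ‖w‖ ≤ C :=
  lp.norm_le_of_forall_le (f := w.1) hC h

@[ext] theorem ext {w z : S.BoundedFamily} (h : ∀ ω, eval ω w = eval ω z) : w = z :=
  Subtype.ext (lp.ext (funext h))

/-- A measurable family of vectors of norm at most `C`, as an element of `S.BoundedFamily`. -/
def mk (w : ∀ ω, S.B ω) (hw : S.MeasurableVec w) (C : ℝ) (hC : ∀ ω, ‖w ω‖ ≤ C) :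
    S.BoundedFamily :=
  ⟨⟨w, memℓp_infty ⟨C, Set.forall_mem_range.2 hC⟩⟩, hw⟩

@[simp] theorem eval_mk (w : ∀ ω, S.B ω) (hw : S.MeasurableVec w) (C : ℝ) (hC : ∀ ω, ‖w ω‖ ≤ C)
    (ω : Ω) : eval ω (mk w hw C hC) = w ω := rfl

instance : One S.BoundedFamily :=
  ⟨mk 1 MeasurableVec.one 1 fun _ => Variation.Space.norm_one.le⟩

theorem eval_one (ω : Ω) : eval ω (1 : S.BoundedFamily) = 1 := rfl

theorem measurable_intCLM_eval (w : S.BoundedFamily) :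
    Measurable fun ω => (S.V ω).intCLM (eval ω w) := (measurableVec_eval w).measurable_intCLM

theorem norm_intCLM_smul_le (w u : S.BoundedFamily) (ω : Ω) :
    ‖(S.V ω).intCLM (eval ω w) • eval ω u‖ ≤ ‖w‖ * ‖u‖ := by
  have hmass : ‖(S.V ω).intCLM (eval ω w)‖ ≤ ‖w‖ :=
    ((S.V ω).intCLM.le_of_opNorm_le Variation.norm_intCLM_le _).trans
      ((one_mul _).trans_le (norm_eval_le w ω))
  rw [norm_smul]
  exact mul_le_mul hmass (norm_eval_le u ω) (norm_nonneg _) (norm_nonneg _)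

/-- The fiberwise product `(w, u) ↦ (∫ w_ω dm_ω • u_ω)_ω`. -/
def intSMul : S.BoundedFamily →L[ℂ] S.BoundedFamily →L[ℂ] S.BoundedFamily :=
  LinearMap.mkContinuous₂ (LinearMap.mk₂ ℂ
    (fun w u => mk (fun ω => (S.V ω).intCLM (eval ω w) • eval ω u)
      ((measurableVec_eval u).smul (measurable_intCLM_eval w)) _
      (norm_intCLM_smul_le w u))
    (fun w z u => ext fun ω => by simp only [eval_mk, map_add, add_smul])
    (fun c w u => ext fun ω => by simp only [eval_mk, map_smul, smul_assoc])
    (fun w u z => ext fun ω => by simp only [eval_mk, map_add, smul_add])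
    (fun c w u => ext fun ω => by simp only [eval_mk, map_smul, smul_comm c])) 1
    fun w u => norm_le_of_forall_le (by positivity) fun ω =>
      (norm_intCLM_smul_le w u ω).trans_eq (by rw [one_mul])

theorem eval_intSMul (w u : S.BoundedFamily) (ω : Ω) :
    eval ω (intSMul w u) = (S.V ω).intCLM (eval ω w) • eval ω u := rfl

/-- The operator `(w_ω)_ω ↦ (a_ω w_ω)_ω` on families, where `a_ω w_ω` sits in the fiber over
`τ ω`. -/
def map (τ : Ω ≃ Ω) (a : ∀ ω, S.B ω →L[ℂ] S.B (τ ω)) (C : ℝ) (hC : ∀ ω, ‖a ω‖ ≤ C)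
    (ha : ∀ w : ∀ ω, S.B ω, S.MeasurableVec w →
      S.MeasurableVec (Equiv.piCongrLeft S.B τ fun ω => a ω (w ω))) :
    S.BoundedFamily →L[ℂ] S.BoundedFamily :=
  have hbound : ∀ (w : S.BoundedFamily) (ω : Ω),
      ‖Equiv.piCongrLeft S.B τ (fun ω => a ω (eval ω w)) ω‖ ≤ max C 0 * ‖w‖ := fun w ω => by
    obtain ⟨ω, rfl⟩ := τ.surjective ω
    rw [Equiv.piCongrLeft_apply_apply]
    exact ((a ω).le_of_opNorm_le ((hC ω).trans (le_max_left C 0)) _).trans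
      (by gcongr; exact norm_eval_le w ω)
  LinearMap.mkContinuous
    { toFun := fun w => mk _ (ha _ (measurableVec_eval w)) _ (hbound w)
      map_add' := fun w z => ext (τ.surjective.forall.2 fun ω => by
        simp only [map_add, eval_mk, Equiv.piCongrLeft_apply_apply])
      map_smul' := fun c w => ext (τ.surjective.forall.2 fun ω => by
        simp only [map_smul, RingHom.id_apply, eval_mk, Equiv.piCongrLeft_apply_apply]) }
    (max C 0) fun w => norm_le_of_forall_le (by positivity) (hbound w)

theorem eval_map (τ : Ω ≃ Ω) (a : ∀ ω, S.B ω →L[ℂ] S.B (τ ω)) (C : ℝ) (hC : ∀ ω, ‖a ω‖ ≤ C)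
    (ha : ∀ w : ∀ ω, S.B ω, S.MeasurableVec w →
      S.MeasurableVec (Equiv.piCongrLeft S.B τ fun ω => a ω (w ω)))
    (w : S.BoundedFamily) (ω : Ω) : eval (τ ω) (map τ a C hC ha w) = a ω (eval ω w) :=
  Equiv.piCongrLeft_apply_apply S.B τ (fun ω => a ω (eval ω w)) ω

end BoundedFamily

end RandomSystem

namespace RandomSystem

variable {Ω X : Type*} [MeasurableSpace Ω] {ℙ : Measure Ω} [MetricSpace X] [MeasurableSpace X]

/-- A measurable cocycle of bounded operators `𝓑_ω → 𝓑_{σω}` that preserves integrals, contracts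
`L¹`-norms and decays exponentially on functions of mean zero. The estimates hold for every `ω`: the
transfer operators of an admissible system coincide almost everywhere with such a cocycle. -/
structure RegularCocycle (S : RandomSystem Ω X ℙ) where
  op : ∀ ω, S.B ω →L[ℂ] S.B (S.σ ω)
  K : ℝ
  r : ℝ
  pos_K : 0 < K
  pos_r : 0 < r
  r_lt_one : r < 1
  norm_op_le : ∀ ω, ‖op ω‖ ≤ K
  norm_val_op_le : ∀ ω h, ‖(op ω h).val‖ ≤ ‖h.val‖
  intCLM_op : ∀ ω h, (S.V (S.σ ω)).intCLM (op ω h) = (S.V ω).intCLM h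
  norm_cocycleIter_le : ∀ n ω h, (S.V ω).intCLM h = 0 →
    ‖cocycleIter (σ := S.σ) (E := S.B) op n ω h‖ ≤ K * r ^ n * ‖h‖
  measurableVec_op : ∀ w, S.MeasurableVec w →
    S.MeasurableVec (Equiv.piCongrLeft S.B S.σ.toEquiv fun ω => op ω (w ω))

namespace BoundedFamily

variable {S : RandomSystem Ω X ℙ} (f : S.BoundedFamily)

/-- The operator of multiplication by a bounded family. -/
def mulFamily : S.BoundedFamily →L[ℂ] S.BoundedFamily :=
  map (Equiv.refl Ω) (fun ω => Variation.mulCLM (eval ω f)) (3 * S.Cvar * ‖f‖)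
    (fun ω => (Variation.norm_mulCLM_le _).trans (by gcongr; exact norm_eval_le f ω))
    fun w hw => by
      rw [Equiv.piCongrLeft_refl]
      exact (measurableVec_eval f).mulCLM hw

theorem eval_mulFamily (w : S.BoundedFamily) (ω : Ω) :
    eval ω (mulFamily f w) = Variation.mulCLM (eval ω f) (eval ω w) :=
  eval_map (Equiv.refl Ω) _ _ _ _ w ω

theorem eval_exp_mulFamily (θ : ℂ) (w : S.BoundedFamily) (ω : Ω) :
    eval ω (NormedSpace.exp (θ • mulFamily f) w) =
      NormedSpace.exp (θ • Variation.mulCLM (eval ω f)) (eval ω w) :=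
  map_exp_apply_of_intertwining (eval ω) (fun w => by
    rw [smul_apply, smul_apply, map_smul, eval_mulFamily]) w

end BoundedFamily

namespace RegularCocycle

open BoundedFamily

variable {S : RandomSystem Ω X ℙ} (R : S.RegularCocycle) (f : S.BoundedFamily)

/-- The cocycle as a single operator on families, `(w_ω)_ω ↦ (L_ω w_ω)_{σω}`. -/
def familyOp : S.BoundedFamily →L[ℂ] S.BoundedFamily :=
  map S.σ.toEquiv R.op R.K R.norm_op_le R.measurableVec_op

theorem eval_familyOp (w : S.BoundedFamily) (ω : Ω) :
    eval (S.σ ω) (R.familyOp w) = R.op ω (eval ω w) :=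
  eval_map S.σ.toEquiv _ _ _ _ w ω

theorem eval_familyOp_pow (n : ℕ) (w : S.BoundedFamily) (ω : Ω) :
    eval (S.σ^[n] ω) ((R.familyOp ^ n) w) =
      cocycleIter (σ := S.σ) (E := S.B) R.op n ω (eval ω w) := by
  induction n generalizing w ω with
  | zero => rfl
  | succ n ih =>
    rw [pow_succ, cocycleIter_succ_apply, ← eval_familyOp, ← ih]
    rfl

theorem norm_familyOp_pow_le {w : S.BoundedFamily} (hw : ∀ ω, (S.V ω).intCLM (eval ω w) = 0)
    (n : ℕ) : ‖(R.familyOp ^ n) w‖ ≤ R.K * R.r ^ n * ‖w‖ := by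
  have hK := R.pos_K
  have hr := R.pos_r
  refine norm_le_of_forall_le (by positivity) ((S.σ.surjective.iterate n).forall.2 fun ω => ?_)
  rw [eval_familyOp_pow]
  exact (R.norm_cocycleIter_le n ω _ (hw ω)).trans (by gcongr; exact norm_eval_le w ω)

/-- The twisted operators `φ ↦ L_ω (e^{θ f_ω} φ)`. The exponential is the one of the multiplication
operator by `f_ω`, which makes its analyticity in `θ` evident. -/
def twisted (θ : ℂ) (ω : Ω) : S.B ω →L[ℂ] S.B (S.σ ω) :=
  (R.op ω).comp (NormedSpace.exp (θ • Variation.mulCLM (eval ω f)))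

/-- The twisted cocycle as a single operator on families. -/
def familyTwisted (θ : ℂ) : S.BoundedFamily →L[ℂ] S.BoundedFamily :=
  R.familyOp.comp (NormedSpace.exp (θ • mulFamily f))

theorem eval_familyTwisted (θ : ℂ) (w : S.BoundedFamily) (ω : Ω) :
    eval (S.σ ω) (R.familyTwisted f θ w) = R.twisted f θ ω (eval ω w) := by
  rw [familyTwisted, ContinuousLinearMap.comp_apply, eval_familyOp, eval_exp_mulFamily, twisted,
    ContinuousLinearMap.comp_apply]

theorem familyTwisted_zero : R.familyTwisted f 0 = R.familyOp := by
  rw [familyTwisted, zero_smul, NormedSpace.exp_zero]; rfl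

theorem twisted_zero (ω : Ω) : R.twisted f 0 ω = R.op ω := by
  rw [twisted, zero_smul, NormedSpace.exp_zero]; rfl

theorem differentiable_twisted (ω : Ω) : Differentiable ℂ fun θ => R.twisted f θ ω :=
  (differentiable_const _).clm_comp (differentiable_exp_smul _)

theorem differentiable_familyTwisted : Differentiable ℂ (R.familyTwisted f) :=
  (differentiable_const _).clm_comp (differentiable_exp_smul _)

theorem norm_twisted_sub_op_le (θ : ℂ) (ω : Ω) :
    ‖R.twisted f θ ω - R.op ω‖ ≤ R.K * (Real.exp (‖θ‖ * (3 * S.Cvar * ‖f‖)) - 1) := by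
  have hK := R.pos_K
  have hnorm : ‖θ • Variation.mulCLM (eval ω f)‖ ≤ ‖θ‖ * (3 * S.Cvar * ‖f‖) := by
    rw [norm_smul]
    gcongr
    exact (Variation.norm_mulCLM_le _).trans (by gcongr; exact norm_eval_le f ω)
  have hfactor : R.twisted f θ ω - R.op ω =
      (R.op ω).comp (NormedSpace.exp (θ • Variation.mulCLM (eval ω f)) - 1) := by
    rw [ContinuousLinearMap.comp_sub]; rfl
  rw [hfactor]
  calc _ ≤ ‖R.op ω‖ * ‖NormedSpace.exp (θ • Variation.mulCLM (eval ω f)) - 1‖ :=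
        ContinuousLinearMap.opNorm_comp_le _ _
    _ ≤ R.K * (Real.exp (‖θ‖ * (3 * S.Cvar * ‖f‖)) - 1) := by
        gcongr
        · exact R.norm_op_le ω
        · exact (norm_exp_sub_one_le_exp_norm_sub_one _).trans (by gcongr)

theorem exists_invariant_density : ∃ v : S.BoundedFamily, R.familyOp v = v ∧
    ∀ ω, ‖(eval ω v).val‖ ≤ 1 ∧ (S.V ω).intCLM (eval ω v) = 1 := by
  let s : Set S.BoundedFamily :=
    {w | ∀ ω, ‖(eval ω w).val‖ ≤ 1 ∧ (S.V ω).intCLM (eval ω w) = 1}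
  have hclosed : IsClosed s := by
    simp only [s, Set.ofPred_forall, Set.ofPred_and]
    exact isClosed_iInter fun ω =>
      (isClosed_le (((S.V ω).valCLM.comp (eval ω)).continuous.norm) continuous_const).inter
        (isClosed_eq ((S.V ω).intCLM.comp (eval ω)).continuous continuous_const)
  have hmaps : Set.MapsTo R.familyOp s s := fun w hw => S.σ.surjective.forall.2 fun ω => by
    rw [eval_familyOp, R.intCLM_op]
    exact ⟨(R.norm_val_op_le ω _).trans (hw ω).1, (hw ω).2⟩
  have hone : 1 ∈ s := fun ω => by
    rw [eval_one]
    exact ⟨(Variation.Space.norm_val_le _).trans_eq Variation.Space.norm_one, Variation.intCLM_one⟩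
  obtain ⟨v, hv, hfix⟩ := exists_mem_map_eq_self_of_norm_pow_le hclosed hmaps hone R.r_lt_one
    (C := R.K * ‖1 - R.familyOp 1‖) fun n => by
      refine (R.norm_familyOp_pow_le (fun ω => ?_) n).trans_eq (by ring)
      rw [map_sub, map_sub, (hone ω).2, (hmaps hone ω).2, sub_self]
  exact ⟨v, hfix, hv⟩

variable {R} in
theorem isUnit_one_sub {v : S.BoundedFamily} (hfix : R.familyOp v = v)
    (hv : ∀ ω, (S.V ω).intCLM (eval ω v) = 1) :
    IsUnit (1 - (R.familyOp - intSMul.flip v * R.familyOp)) := by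
  have hidem : IsIdempotentElem (intSMul.flip v) := ContinuousLinearMap.ext fun w => ext fun ω => by
    simp only [mul_apply_eq_comp, ContinuousLinearMap.flip_apply, eval_intSMul,
      map_smul, hv, smul_eq_mul, mul_one]
  have hcomm : Commute (intSMul.flip v) R.familyOp := ContinuousLinearMap.ext fun w =>
    ext (S.σ.surjective.forall.2 fun ω => by
      simp only [mul_apply_eq_comp, ContinuousLinearMap.flip_apply, eval_intSMul,
        eval_familyOp, R.intCLM_op, map_smul]
      rw [← eval_familyOp, hfix])
  refine isUnit_one_sub_of_norm_pow_le_on_ker hidem hcomm R.pos_K.le R.pos_r.le R.r_lt_one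
    fun n w hw => R.norm_familyOp_pow_le (fun ω => ?_) n
  have hω := congrArg (fun w => (S.V ω).intCLM (eval ω w)) hw
  simpa only [ContinuousLinearMap.flip_apply, eval_intSMul, map_smul, hv, smul_eq_mul, mul_one,
    map_zero] using hω

end RegularCocycle

end RandomSystem

namespace RandomSystem

variable {Ω X : Type*} [MeasurableSpace Ω] {ℙ : Measure Ω} [MetricSpace X] [MeasurableSpace X]
  {S : RandomSystem Ω X ℙ}

theorem iterOp_eq_cocycleIter (A : ∀ ω, S.B ω →L[ℂ] S.B (S.σ ω)) (n : ℕ) (ω : Ω) :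
    S.iterOp A n ω = cocycleIter (σ := S.σ) (E := S.B) A n ω := by
  induction n generalizing ω with
  | zero => rfl
  | succ n ih => exact congrArg (·.comp (A ω)) (ih (S.σ ω))

namespace RegularCocycle

open BoundedFamily

variable (R : S.RegularCocycle) (f : S.BoundedFamily)

theorem measurableVec_twisted (θ : ℂ) {w : ∀ ω, S.B ω} (hw : S.MeasurableVec w) :
    S.MeasurableVec (Equiv.piCongrLeft S.B S.σ.toEquiv fun ω => R.twisted f θ ω (w ω)) :=
  R.measurableVec_op _ ((measurableVec_eval f).exp_mulCLM θ hw)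

/-- The contraction rate, transversally to vectors of norm at most `C`, of cocycles
`2 * δ * (1 + K)`-close to `R`. -/
def perturbedRate (δ C : ℝ) : ℝ := R.r + R.K * ((1 + C) * (2 * δ * (1 + R.K)))

theorem exists_perturbedRate_lt (C : ℝ) :
    ∃ δ : ℝ, 0 < δ ∧ δ ≤ 1 / 2 ∧ (1 + δ) * R.perturbedRate δ C < 1 := by
  have hcont : Continuous fun δ => (1 + δ) * R.perturbedRate δ C := by
    simp only [perturbedRate]
    fun_prop
  have hrate : ∀ᶠ δ in 𝓝[>] 0, (1 + δ) * R.perturbedRate δ C < 1 := nhdsWithin_le_nhds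
    ((hcont.tendsto 0).eventually_lt_const (by simpa [perturbedRate] using R.r_lt_one))
  obtain ⟨δ, hδ, hpos, hhalf⟩ := (hrate.and (Ioc_mem_nhdsGT one_half_pos)).exists
  exact ⟨δ, hpos, hhalf, hδ⟩

/-- The vectors `u θ` are eigenvectors of the twisted cocycles, depend analytically on `θ ∈ U`, and
start from an invariant density at `θ = 0`. The numbers `δ` and `C` measure how far the twisted
cocycles are from the original one; they are small enough for its contraction to survive. -/
structure IsEigenfamily (u : ℂ → S.BoundedFamily) (U : Set ℂ) (δ C : ℝ) : Prop where
  isOpen : IsOpen U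
  zero_mem : 0 ∈ U
  differentiableOn : DifferentiableOn ℂ u U
  intCLM_zero : ∀ ω, (S.V ω).intCLM (eval ω (u 0)) = 1
  map_eq : ∀ θ ∈ U, R.familyTwisted f θ (u θ) = intSMul (R.familyTwisted f θ (u θ)) (u θ)
  norm_le : ∀ θ ∈ U, ‖u θ‖ ≤ C
  norm_map_sub_le : ∀ θ ∈ U, ‖R.familyTwisted f θ (u θ) - u 0‖ ≤ δ
  norm_twisted_sub_le : ∀ θ ∈ U, ∀ ω, ‖R.twisted f θ ω - R.op ω‖ ≤ δ
  pos : 0 < δ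
  le_half : δ ≤ 1 / 2
  rate_lt_one : (1 + δ) * R.perturbedRate δ C < 1

variable {R} in
theorem exists_analytic_family {v : S.BoundedFamily} (hfix : R.familyOp v = v)
    (hv : ∀ ω, (S.V ω).intCLM (eval ω v) = 1) :
    ∃ u : ℂ → S.BoundedFamily, u 0 = v ∧ AnalyticAt ℂ u 0 ∧
      ∀ᶠ θ in 𝓝 0, R.familyTwisted f θ (u θ) = intSMul (R.familyTwisted f θ (u θ)) (u θ) :=
  exists_analytic_eigenvector ((R.differentiable_familyTwisted f).analyticAt 0)
    (by rw [familyTwisted_zero, hfix])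
    (fun w => BoundedFamily.ext fun ω => by rw [eval_intSMul, hv, one_smul])
    (by rw [familyTwisted_zero]; exact isUnit_one_sub hfix hv)

theorem eventually_norm_twisted_sub_le {δ : ℝ} (hδ : 0 < δ) :
    ∀ᶠ θ in 𝓝 (0 : ℂ), ∀ ω, ‖R.twisted f θ ω - R.op ω‖ ≤ δ := by
  have hcont : Continuous fun θ : ℂ =>
      R.K * (Real.exp (‖θ‖ * (3 * S.Cvar * ‖f‖)) - 1) := by fun_prop
  filter_upwards [(hcont.tendsto 0).eventually_le_const (by simpa using hδ)] with θ hθ ω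
  exact (R.norm_twisted_sub_op_le f θ ω).trans hθ

variable {R} in
theorem exists_isEigenfamily {v : S.BoundedFamily} (hfix : R.familyOp v = v)
    (hv : ∀ ω, (S.V ω).intCLM (eval ω v) = 1) :
    ∃ u U δ C, u 0 = v ∧ R.IsEigenfamily f u U δ C := by
  obtain ⟨u, rfl, hu, heigen⟩ := exists_analytic_family f hfix hv
  obtain ⟨δ, hδ, hhalf, hrate⟩ := R.exists_perturbedRate_lt (‖u 0‖ + 1)
  have hnorm : ∀ᶠ θ in 𝓝 0, ‖u θ‖ ≤ ‖u 0‖ + 1 :=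
    hu.continuousAt.norm.eventually_le_const (lt_add_one _)
  have hmap : ∀ᶠ θ in 𝓝 0, ‖R.familyTwisted f θ (u θ) - u 0‖ ≤ δ := by
    refine ((((R.differentiable_familyTwisted f).continuous.continuousAt.clm_apply
      hu.continuousAt).sub continuousAt_const).norm).eventually_le_const ?_
    beta_reduce
    rw [Pi.sub_apply, familyTwisted_zero, hfix, sub_self, norm_zero]
    exact hδ
  obtain ⟨U, hU, hopen, hzero⟩ := eventually_nhds_iff.1 (hu.eventually_analyticAt.and
    (heigen.and (hnorm.and (hmap.and (R.eventually_norm_twisted_sub_le f hδ)))))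
  exact ⟨u, U, δ, ‖u 0‖ + 1, rfl, hopen, hzero,
    fun θ hθ => (hU θ hθ).1.differentiableAt.differentiableWithinAt, hv,
    fun θ hθ => (hU θ hθ).2.1, fun θ hθ => (hU θ hθ).2.2.1, fun θ hθ => (hU θ hθ).2.2.2.1,
    fun θ hθ => (hU θ hθ).2.2.2.2, hδ, hhalf, hrate⟩

variable (u : ℂ → S.BoundedFamily)

/-- The eigenvalue `λ^θ_ω`, read off by integrating `L^θ_ω u^θ_ω = λ^θ_ω u^θ_{σω}`. -/
def eigenvalue (θ : ℂ) (ω : Ω) : ℂ := (S.V (S.σ ω)).intCLM (R.twisted f θ ω (eval ω (u θ)))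

/-- The twisted cocycle divided by its eigenvalues. -/
def normalized (θ : ℂ) (ω : Ω) : S.B ω →L[ℂ] S.B (S.σ ω) :=
  (R.eigenvalue f u θ ω)⁻¹ • R.twisted f θ ω

/-- The dual eigenfunctional `φ^θ_ω`. -/
def eigenfunctional (θ : ℂ) (ω : Ω) : S.B ω →L[ℂ] ℂ :=
  dualFunctional (σ := S.σ) (E := S.B) (fun ω => (S.V ω).intCLM) (R.normalized f u θ) ω

theorem eigenvalue_eq (θ : ℂ) (ω : Ω) : R.eigenvalue f u θ ω =
    (S.V (S.σ ω)).intCLM (eval (S.σ ω) (R.familyTwisted f θ (u θ))) := by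
  rw [eval_familyTwisted, eigenvalue]

theorem measurable_eigenvalue (θ : ℂ) : Measurable (R.eigenvalue f u θ) :=
  (congrArg Measurable (funext (R.eigenvalue_eq f u θ))).mpr
    ((measurable_intCLM_eval (R.familyTwisted f θ (u θ))).comp S.σ.measurable)

theorem measurable_pullback (θ : ℂ) (n : ℕ) {γ : ∀ ω, S.B ω} (hγ : S.MeasurableVec γ) :
    Measurable fun ω => pullback (σ := S.σ) (E := S.B) (fun ω => (S.V ω).intCLM)
      (R.normalized f u θ) n ω (γ ω) := by
  induction n generalizing γ with
  | zero => exact hγ.measurable_intCLM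
  | succ n ih =>
    have hnext := (ih (R.measurableVec_twisted f θ hγ)).comp S.σ.measurable
    refine (congrArg Measurable (funext fun ω => ?_)).mp
      ((R.measurable_eigenvalue f u θ).inv.mul hnext)
    rw [pullback_succ, ContinuousLinearMap.comp_apply, normalized, smul_apply, map_smul,
      smul_eq_mul, Pi.mul_apply, Function.comp_apply, Pi.inv_apply]
    exact congrArg (_ * pullback _ _ n (S.σ ω) ·)
      (Equiv.piCongrLeft_apply_apply S.B S.σ.toEquiv _ ω)

namespace IsEigenfamily

variable {R f u} {U : Set ℂ} {δ C : ℝ} {θ : ℂ}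

theorem norm_eigenvalue_sub_one_le (H : R.IsEigenfamily f u U δ C) (hθ : θ ∈ U) (ω : Ω) :
    ‖R.eigenvalue f u θ ω - 1‖ ≤ δ := by
  rw [eigenvalue_eq, ← H.intCLM_zero (S.σ ω), ← map_sub, ← map_sub]
  exact ((S.V _).intCLM.le_of_opNorm_le Variation.norm_intCLM_le _).trans
    ((one_mul _).trans_le ((norm_eval_le _ _).trans (H.norm_map_sub_le θ hθ)))

theorem half_le_norm_eigenvalue (H : R.IsEigenfamily f u U δ C) (hθ : θ ∈ U) (ω : Ω) :
    1 / 2 ≤ ‖R.eigenvalue f u θ ω‖ := by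
  have htri := norm_sub_norm_le (1 : ℂ) (R.eigenvalue f u θ ω)
  rw [norm_sub_rev, norm_one] at htri
  linarith [H.norm_eigenvalue_sub_one_le hθ ω, H.le_half]

theorem eigenvalue_ne_zero (H : R.IsEigenfamily f u U δ C) (hθ : θ ∈ U) (ω : Ω) :
    R.eigenvalue f u θ ω ≠ 0 :=
  norm_pos_iff.1 (one_half_pos.trans_le (H.half_le_norm_eigenvalue hθ ω))

theorem norm_eigenvalue_le (H : R.IsEigenfamily f u U δ C) (hθ : θ ∈ U) (ω : Ω) :
    ‖R.eigenvalue f u θ ω‖ ≤ 1 + δ := by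
  have htri := norm_sub_norm_le (R.eigenvalue f u θ ω) (1 : ℂ)
  rw [norm_one] at htri
  linarith [H.norm_eigenvalue_sub_one_le hθ ω]

theorem twisted_eq (H : R.IsEigenfamily f u U δ C) (hθ : θ ∈ U) (ω : Ω) :
    R.twisted f θ ω = R.eigenvalue f u θ ω • R.normalized f u θ ω := by
  rw [normalized, smul_inv_smul₀ (H.eigenvalue_ne_zero hθ ω)]

theorem twisted_eigenvector (H : R.IsEigenfamily f u U δ C) (hθ : θ ∈ U) (ω : Ω) :
    R.twisted f θ ω (eval ω (u θ)) = R.eigenvalue f u θ ω • eval (S.σ ω) (u θ) := by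
  have hω := congrArg (eval (S.σ ω)) (H.map_eq θ hθ)
  rwa [eval_intSMul, ← eigenvalue_eq, eval_familyTwisted] at hω

theorem normalized_eigenvector (H : R.IsEigenfamily f u U δ C) (hθ : θ ∈ U) (ω : Ω) :
    R.normalized f u θ ω (eval ω (u θ)) = eval (S.σ ω) (u θ) := by
  rw [normalized, smul_apply, H.twisted_eigenvector hθ,
    inv_smul_smul₀ (H.eigenvalue_ne_zero hθ ω)]

theorem intCLM_eigenvector (H : R.IsEigenfamily f u U δ C) (hθ : θ ∈ U) :
    ∀ ω, (S.V ω).intCLM (eval ω (u θ)) = 1 :=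
  S.σ.surjective.forall.2 fun ω => by
    have hω : R.eigenvalue f u θ ω = _ := congrArg (S.V _).intCLM (H.twisted_eigenvector hθ ω)
    rw [map_smul, smul_eq_mul] at hω
    exact (mul_eq_left₀ (H.eigenvalue_ne_zero hθ ω)).1 hω.symm

theorem norm_normalized_sub_le (H : R.IsEigenfamily f u U δ C) (hθ : θ ∈ U) (ω : Ω) :
    ‖R.normalized f u θ ω - R.op ω‖ ≤ 2 * δ * (1 + R.K) := by
  have hl := H.eigenvalue_ne_zero hθ ω
  have hsplit : R.normalized f u θ ω - R.op ω = (R.eigenvalue f u θ ω)⁻¹ •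
      ((R.twisted f θ ω - R.op ω) + (1 - R.eigenvalue f u θ ω) • R.op ω) := by
    rw [normalized, sub_smul, one_smul, sub_add_sub_cancel, smul_sub, inv_smul_smul₀ hl]
  have hinv : ‖(R.eigenvalue f u θ ω)⁻¹‖ ≤ 2 := by
    rw [norm_inv, ← inv_inv (2 : ℝ), ← one_div (2 : ℝ)]
    exact inv_anti₀ one_half_pos (H.half_le_norm_eigenvalue hθ ω)
  have hδ := H.pos
  calc _ ≤ 2 * (δ + δ * R.K) := by
        rw [hsplit, norm_smul]
        refine mul_le_mul hinv ((norm_add_le _ _).trans (add_le_add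
          (H.norm_twisted_sub_le θ hθ ω) ?_)) (norm_nonneg _) zero_le_two
        rw [norm_smul, norm_sub_rev]
        exact mul_le_mul (H.norm_eigenvalue_sub_one_le hθ ω) (R.norm_op_le ω) (norm_nonneg _) hδ.le
    _ = 2 * δ * (1 + R.K) := by ring

theorem nonneg_const (H : R.IsEigenfamily f u U δ C) : 0 ≤ C :=
  (norm_nonneg _).trans (H.norm_le 0 H.zero_mem)

theorem perturbedRate_pos (H : R.IsEigenfamily f u U δ C) : 0 < R.perturbedRate δ C := by
  have hr := R.pos_r
  have hK := R.pos_K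
  have hC := H.nonneg_const
  have hδ := H.pos
  unfold perturbedRate
  positivity

theorem hasSpectralGap (H : R.IsEigenfamily f u U δ C) (hθ : θ ∈ U) :
    HasSpectralGap (σ := S.σ) (E := S.B) (fun ω => (S.V ω).intCLM) (R.normalized f u θ)
      (fun ω => eval ω (u θ)) (C + 2 * R.K + 1) (R.perturbedRate δ C) where
  norm_functional_le _ := Variation.norm_intCLM_le
  functional_vec := H.intCLM_eigenvector hθ
  map_vec := H.normalized_eigenvector hθ
  norm_vec_le ω := by
    linarith [norm_eval_le (u θ) ω, H.norm_le θ hθ, R.pos_K]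
  norm_map_le ω := by
    have htri := norm_le_norm_add_norm_sub' (R.normalized f u θ ω) (R.op ω)
    nlinarith [H.norm_normalized_sub_le hθ ω, R.norm_op_le ω, R.pos_K, H.nonneg_const, H.le_half]
  norm_transversal_le n ω h hh := by
    have hr := H.perturbedRate_pos
    have hδ := H.pos
    have hK := R.pos_K
    have hC := H.nonneg_const
    refine (norm_cocycleIter_transversal_le (σ := S.σ) (E := S.B)
      (fun _ => Variation.norm_intCLM_le) R.intCLM_op (H.intCLM_eigenvector hθ)
      (fun ω => (norm_eval_le (u θ) ω).trans (H.norm_le θ hθ)) hC hK.le R.pos_r.le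
      (by positivity) R.norm_cocycleIter_le (H.norm_normalized_sub_le hθ) n hh).trans ?_
    change R.K * R.perturbedRate δ C ^ n * ‖h‖ ≤ _
    gcongr
    linarith
  pos_const := by linarith [R.pos_K, H.nonneg_const]
  pos_rate := H.perturbedRate_pos
  rate_lt_one := by nlinarith [H.rate_lt_one, H.perturbedRate_pos, H.pos]

theorem measurableDual (H : R.IsEigenfamily f u U δ C) (hθ : θ ∈ U) :
    S.MeasurableDual (R.eigenfunctional f u θ) := fun g γ hg hγ =>
  measurable_of_tendsto_metrizable (fun n => R.measurable_pullback f u θ n ⟨g, hg, hγ⟩)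
    (tendsto_pi_nhds.2 fun ω => (H.hasSpectralGap hθ).tendsto_pullback_apply ω (γ ω))

theorem eigenfunctional_comp (H : R.IsEigenfamily f u U δ C) (hθ : θ ∈ U) (ω : Ω) :
    (R.eigenfunctional f u θ (S.σ ω)).comp (R.twisted f θ ω) =
      R.eigenvalue f u θ ω • R.eigenfunctional f u θ ω := by
  rw [H.twisted_eq hθ, ContinuousLinearMap.comp_smul]
  exact congrArg _ ((H.hasSpectralGap hθ).dualFunctional_comp ω)

theorem eigenfunctional_eigenvector (H : R.IsEigenfamily f u U δ C) (hθ : θ ∈ U) (ω : Ω) :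
    R.eigenfunctional f u θ ω (eval ω (u θ)) = 1 :=
  (H.hasSpectralGap hθ).dualFunctional_vec ω

theorem eigenvalue_zero (H : R.IsEigenfamily f u U δ C) (ω : Ω) : R.eigenvalue f u 0 ω = 1 := by
  rw [eigenvalue, twisted_zero, R.intCLM_op, H.intCLM_zero]

theorem eigenfunctional_zero (H : R.IsEigenfamily f u U δ C) (ω : Ω) :
    R.eigenfunctional f u 0 ω = (S.V ω).intCLM :=
  dualFunctional_eq_self (σ := S.σ) (E := S.B) (fun ω => by
    rw [normalized, H.eigenvalue_zero, inv_one, one_smul, twisted_zero]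
    exact ContinuousLinearMap.ext (R.intCLM_op ω)) ω

theorem differentiableOn_eigenvector (H : R.IsEigenfamily f u U δ C) (ω : Ω) :
    DifferentiableOn ℂ (fun θ => eval ω (u θ)) U :=
  (eval ω).differentiable.comp_differentiableOn H.differentiableOn

theorem differentiableOn_eigenvalue (H : R.IsEigenfamily f u U δ C) (ω : Ω) :
    DifferentiableOn ℂ (fun θ => R.eigenvalue f u θ ω) U :=
  (S.V (S.σ ω)).intCLM.differentiable.comp_differentiableOn
    ((R.differentiable_twisted f ω).differentiableOn.clm_apply (H.differentiableOn_eigenvector ω))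

theorem differentiableOn_eigenfunctional (H : R.IsEigenfamily f u U δ C) (ω : Ω) :
    DifferentiableOn ℂ (fun θ => R.eigenfunctional f u θ ω) U :=
  differentiableOn_dualFunctional (σ := S.σ) (E := S.B) H.isOpen
    (fun ω => ((H.differentiableOn_eigenvalue ω).inv fun _ hθ => H.eigenvalue_ne_zero hθ ω).smul
      (R.differentiable_twisted f ω).differentiableOn)
    (fun _ hθ => H.hasSpectralGap hθ) ω

theorem exists_norm_le (H : R.IsEigenfamily f u U δ C) : ∃ B : ℝ, 0 < B ∧ ∀ ω, ∀ θ ∈ U,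
    max ‖R.eigenvalue f u θ ω‖ (max ‖eval ω (u θ)‖ ‖R.eigenfunctional f u θ ω‖) ≤ B :=
  ⟨max (1 + δ) (max C _), lt_max_of_lt_left (by linarith [H.pos]), fun ω _ hθ =>
    max_le_max (H.norm_eigenvalue_le hθ ω) (max_le_max ((norm_eval_le _ ω).trans (H.norm_le _ hθ))
      ((H.hasSpectralGap hθ).norm_dualFunctional_le ω))⟩

theorem exists_norm_iterOp_sub_le (H : R.IsEigenfamily f u U δ C) : ∃ c r : ℝ,
    0 < c ∧ 0 < r ∧ r < 1 ∧ ∀ ω (n : ℕ) (h : S.B ω), ∀ θ ∈ U,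
      ‖S.iterOp (R.twisted f θ) n ω h - ((∏ i ∈ Finset.range n, R.eigenvalue f u θ (S.σ^[i] ω)) *
        R.eigenfunctional f u θ ω h) • eval (S.σ^[n] ω) (u θ)‖ ≤ c * r ^ n * ‖h‖ := by
  have hgap := H.hasSpectralGap H.zero_mem
  have hA := hgap.pos_const
  have hr := hgap.pos_rate
  have hr1 := sub_pos.2 hgap.rate_lt_one
  have hδ := H.pos
  set A := C + 2 * R.K + 1
  set ρ := R.perturbedRate δ C
  refine ⟨A ^ 3 * (1 + A) / (1 - ρ) + A * (1 + A), (1 + δ) * ρ, by positivity, by positivity,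
    H.rate_lt_one, fun ω n h θ hθ => ?_⟩
  have hprod : ‖∏ i ∈ Finset.range n, R.eigenvalue f u θ (S.σ^[i] ω)‖ ≤ (1 + δ) ^ n := by
    rw [norm_prod]
    exact (Finset.prod_le_prod (fun _ _ => norm_nonneg _) fun i _ =>
      H.norm_eigenvalue_le hθ _).trans_eq (by rw [Finset.prod_const, Finset.card_range])
  rw [iterOp_eq_cocycleIter, funext (H.twisted_eq hθ),
    cocycleIter_smul (σ := S.σ) (E := S.B) (R.normalized f u θ), smul_apply, mul_smul, ← smul_sub,
    norm_smul]
  refine (mul_le_mul hprod ((H.hasSpectralGap hθ).norm_cocycleIter_sub_le n ω h)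
    (norm_nonneg _) (by positivity)).trans_eq ?_
  rw [mul_pow]
  ring

end IsEigenfamily

end RegularCocycle

end RandomSystem

theorem exists_measurableSet_mapsTo_of_ae {α : Type*} [MeasurableSpace α] {μ : Measure α}
    {τ : α → α} (hτ : Measure.QuasiMeasurePreserving τ μ μ) {p : α → Prop} (h : ∀ᵐ a ∂μ, p a) :
    ∃ A : Set α, MeasurableSet A ∧ Set.MapsTo τ A A ∧ (∀ᵐ a ∂μ, a ∈ A) ∧ ∀ a ∈ A, p a := by
  obtain ⟨s, hs, hsm, hs0⟩ := exists_measurable_superset_of_null h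
  have hsc : ∀ᵐ a ∂μ, a ∈ sᶜ := measure_eq_zero_iff_ae_notMem.1 hs0
  refine ⟨⋂ n : ℕ, τ^[n] ⁻¹' sᶜ, .iInter fun n => (hτ.measurable.iterate n) hsm.compl,
    fun a ha => ?_, ?_, fun a ha => ?_⟩
  · exact Set.mem_iInter.2 fun n => Set.mem_iInter.1 ha (n + 1)
  · filter_upwards [ae_all_iff.2 fun n => (hτ.iterate n).ae hsc] with a ha
    exact Set.mem_iInter.2 ha
  · by_contra hp
    exact Set.mem_iInter.1 ha 0 (hs hp)

namespace RandomSystem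

variable {Ω X : Type*} [MeasurableSpace Ω] {ℙ : Measure Ω} [MetricSpace X] [MeasurableSpace X]
  {S : RandomSystem Ω X ℙ}

theorem transfer_add (ω : Ω) (φ ψ : Lp ℂ 1 (S.m ω)) :
    S.transfer ω (φ + ψ) = S.transfer ω φ + S.transfer ω ψ :=
  (transferL1_congr (Lp.coeFn_add φ ψ)).trans (transferL1_add (S.measurable_fiberMap ω)
    (S.nonsingular ω) (L1.integrable_coeFn φ) (L1.integrable_coeFn ψ))

theorem transfer_smul (ω : Ω) (c : ℂ) (φ : Lp ℂ 1 (S.m ω)) :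
    S.transfer ω (c • φ) = c • S.transfer ω φ :=
  (transferL1_congr (Lp.coeFn_smul c φ)).trans (transferL1_smul (S.measurable_fiberMap ω)
    (S.nonsingular ω) c (L1.integrable_coeFn φ))

theorem norm_transfer_le (ω : Ω) (φ : Lp ℂ 1 (S.m ω)) : ‖S.transfer ω φ‖ ≤ ‖φ‖ :=
  (norm_transferL1_le (S.measurable_fiberMap ω) (S.nonsingular ω)
    (L1.integrable_coeFn φ)).trans_eq (L1.norm_eq_integral_norm φ).symm

theorem val_cocycleIter {A : ∀ ω, S.B ω →L[ℂ] S.B (S.σ ω)} {ω : Ω}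
    (hA : ∀ k, ∀ φ, (A (S.σ^[k] ω) φ).val = S.transfer (S.σ^[k] ω) φ.val) (n : ℕ) (φ : S.B ω) :
    (cocycleIter (σ := S.σ) (E := S.B) A n ω φ).val = S.transferIter n ω φ.val := by
  induction n generalizing ω with
  | zero => rfl
  | succ n ih =>
    exact (ih (fun k => hA (k + 1)) _).trans (congrArg (S.transferIter n (S.σ ω)) (hA 0 φ))

theorem exists_transfer_clm {ω : Ω} {K : ℝ} (hK : 0 ≤ K)
    (h : ∀ φ : Lp ℂ 1 (S.m ω), (S.V ω).var φ < ∞ →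
      (S.V (S.σ ω)).bnorm (S.transfer ω φ) ≤ ENNReal.ofReal K * (S.V ω).bnorm φ) :
    ∃ a : S.B ω →L[ℂ] S.B (S.σ ω), ‖a‖ ≤ K ∧ ∀ φ, (a φ).val = S.transfer ω φ.val := by
  have hle : ∀ φ : S.B ω, (S.V (S.σ ω)).bnorm (S.transfer ω φ.val) ≤ ENNReal.ofReal (K * ‖φ‖) :=
    fun φ => (h _ φ.var_lt_top).trans_eq (by
      rw [Variation.Space.bnorm_val, ENNReal.ofReal_mul hK])
  have hvar : ∀ φ : S.B ω, (S.V (S.σ ω)).var (S.transfer ω φ.val) < ∞ := fun φ =>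
    (le_add_self.trans (hle φ)).trans_lt ENNReal.ofReal_lt_top
  refine ⟨LinearMap.mkContinuous
    { toFun := fun φ => Variation.Space.mk _ (hvar φ)
      map_add' := fun φ ψ => Variation.Space.val_injective (transfer_add ω φ.val ψ.val)
      map_smul' := fun c φ => Variation.Space.val_injective (transfer_smul ω c φ.val) } K
    fun φ => (Variation.Space.norm_le_iff _ (by positivity)).2 (hle φ),
    LinearMap.mkContinuous_norm_le _ hK _, fun φ => rfl⟩

/-- The averaging operator `φ ↦ ∫ φ • 1`, which stands in for the transfer operator where the
almost sure hypotheses fail. -/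
def averageCLM (S : RandomSystem Ω X ℙ) (ω : Ω) : S.B ω →L[ℂ] S.B (S.σ ω) :=
  (S.V ω).intCLM.smulRight 1

theorem averageCLM_apply (ω : Ω) (φ : S.B ω) :
    S.averageCLM ω φ = (S.V ω).intCLM φ • (1 : S.B (S.σ ω)) := rfl

theorem norm_averageCLM_le (ω : Ω) : ‖S.averageCLM ω‖ ≤ 1 := by
  rw [averageCLM, ContinuousLinearMap.norm_smulRight_apply, Variation.Space.norm_one, mul_one]
  exact Variation.norm_intCLM_le

theorem norm_val_averageCLM_le (ω : Ω) (φ : S.B ω) : ‖(S.averageCLM ω φ).val‖ ≤ ‖φ.val‖ := by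
  refine (Variation.Space.norm_val_le _).trans ?_
  rw [averageCLM_apply, norm_smul, Variation.Space.norm_one, mul_one]
  exact Variation.norm_intCLM_apply_le φ

theorem intCLM_averageCLM (ω : Ω) (φ : S.B ω) :
    (S.V (S.σ ω)).intCLM (S.averageCLM ω φ) = (S.V ω).intCLM φ := by
  rw [averageCLM_apply, map_smul, Variation.intCLM_one, smul_eq_mul, mul_one]

theorem norm_cocycleIter_le_of_eq_averageCLM {A : ∀ ω, S.B ω →L[ℂ] S.B (S.σ ω)} {ω : Ω}
    (hA : A ω = S.averageCLM ω) {C r : ℝ} (hC : 1 ≤ C) (hr : 0 ≤ r) (n : ℕ) {φ : S.B ω}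
    (hφ : (S.V ω).intCLM φ = 0) :
    ‖cocycleIter (σ := S.σ) (E := S.B) A n ω φ‖ ≤ C * r ^ n * ‖φ‖ := by
  cases n with
  | zero => exact le_mul_of_one_le_left (norm_nonneg _) (hC.trans_eq (by simp))
  | succ n =>
    have hzero : cocycleIter (σ := S.σ) (E := S.B) A n (S.σ ω) (A ω φ) = 0 := by
      rw [hA, averageCLM_apply, hφ, zero_smul, map_zero]
    exact (norm_eq_zero.2 hzero).trans_le (by positivity)

theorem norm_cocycleIter_le_of_eq_transfer {A : ∀ ω, S.B ω →L[ℂ] S.B (S.σ ω)} {ω : Ω}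
    (hA : ∀ k, ∀ φ, (A (S.σ^[k] ω) φ).val = S.transfer (S.σ^[k] ω) φ.val) {C κ : ℝ} (hC : 0 ≤ C)
    (n : ℕ) {φ : S.B ω} (hφ : (S.V (S.σ^[n] ω)).bnorm (S.transferIter n ω φ.val) ≤
      ENNReal.ofReal (C * Real.exp (-κ * n)) * (S.V ω).bnorm φ.val) :
    ‖cocycleIter (σ := S.σ) (E := S.B) A n ω φ‖ ≤ C * Real.exp (-κ) ^ n * ‖φ‖ := by
  rwa [Variation.Space.norm_le_iff _ (by positivity), val_cocycleIter hA,
    ENNReal.ofReal_mul (by positivity), ← Variation.Space.bnorm_val, ← Real.exp_nat_mul,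
    mul_comm (n : ℝ)]

theorem MeasurableVec.piecewise_transfer [MeasurableSpace.CountablyGenerated X]
    {w z : ∀ ω, S.B ω} (hw : S.MeasurableVec w) {A : Set Ω} (hA : MeasurableSet A)
    (hz : ∀ ω ∈ A, (z (S.σ ω)).val = S.transfer ω (w ω).val)
    (hzc : ∀ ω ∉ A, z (S.σ ω) = S.averageCLM ω (w ω)) : S.MeasurableVec z := by
  classical
  obtain ⟨g, hg, hgw⟩ := id hw
  obtain ⟨-, G, hG, hgG⟩ := HasMeasurableTransfer.of_measurable hg fun ω =>
    (L1.integrable_coeFn _).congr (hgw ω)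
  have hsymm : Measurable fun p : S.𝒳 => S.σ.symm p.1.1 :=
    S.σ.symm.measurable.comp S.measurable_base
  refine ⟨{p : S.𝒳 | S.σ.symm p.1.1 ∈ A}.piecewise G
    fun p => (S.V (S.σ.symm p.1.1)).intCLM (w (S.σ.symm p.1.1)),
    hG.piecewise (hsymm hA) (hw.measurable_intCLM.comp hsymm), S.σ.surjective.forall.2 fun ω => ?_⟩
  by_cases hω : ω ∈ A
  · rw [hz ω hω, RandomSystem.transfer, transferL1_congr (hgw ω)]
    filter_upwards [hgG ω] with x hx
    simp [hx, sect, Set.piecewise, hω]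
  · rw [hzc ω hω, averageCLM_apply, Variation.Space.val_smul]
    filter_upwards [Lp.coeFn_smul ((S.V ω).intCLM (w ω)) (1 : S.B (S.σ ω)).val,
      (Variation.Space.val_one_ae_eq : (1 : S.B (S.σ ω)).val =ᵐ[_] _)] with x hx h1
    simp only [hx, h1, sect, Set.piecewise, Set.mem_ofPred_eq, S.σ.symm_apply_apply, hω, if_false,
      Pi.smul_apply, smul_eq_mul, mul_one]
    exact congrArg (fun ω => (S.V ω).intCLM (w ω)) (S.σ.symm_apply_apply ω).symm

theorem exists_regularCocycle [MeasurableSpace.CountablyGenerated X]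
    (hbounded : ∃ K : ℝ, 0 < K ∧ ∀ᵐ ω ∂ℙ, ∀ φ : Lp ℂ 1 (S.m ω), (S.V ω).var φ < ∞ →
      (S.V (S.σ ω)).bnorm (S.transfer ω φ) ≤ ENNReal.ofReal K * (S.V ω).bnorm φ)
    (hdecay : ∃ C κ : ℝ, 0 < C ∧ 0 < κ ∧ ∀ᵐ ω ∂ℙ, ∀ n : ℕ, ∀ φ : Lp ℂ 1 (S.m ω),
      (S.V ω).var φ < ∞ → ∫ x, φ x ∂(S.m ω) = 0 →
      (S.V (S.σ^[n] ω)).bnorm (S.transferIter n ω φ) ≤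
        ENNReal.ofReal (C * Real.exp (-κ * n)) * (S.V ω).bnorm φ) :
    ∃ R : S.RegularCocycle, ∀ᵐ ω ∂ℙ, ∀ φ, (R.op ω φ).val = S.transfer ω φ.val := by
  obtain ⟨K, hK, hKb⟩ := hbounded
  obtain ⟨C, κ, hC, hκ, hdec⟩ := hdecay
  obtain ⟨A, hAm, hAσ, hAae, hA⟩ := exists_measurableSet_mapsTo_of_ae
    S.ergodic.toMeasurePreserving.quasiMeasurePreserving (hKb.and hdec)
  have hop : ∀ ω, ∃ a : S.B ω →L[ℂ] S.B (S.σ ω), ‖a‖ ≤ max 1 K ∧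
      (ω ∈ A → ∀ φ, (a φ).val = S.transfer ω φ.val) ∧ (ω ∉ A → a = S.averageCLM ω) := fun ω => by
    by_cases hω : ω ∈ A
    · obtain ⟨a, haK, ha⟩ := exists_transfer_clm hK.le (hA ω hω).1
      exact ⟨a, haK.trans (le_max_right _ _), fun _ => ha, fun h => absurd hω h⟩
    · exact ⟨_, (norm_averageCLM_le ω).trans (le_max_left _ _), fun h => absurd h hω, fun _ => rfl⟩
  choose op hopK hopA hopc using hop
  refine ⟨⟨op, max (max 1 K) C, Real.exp (-κ), by positivity, Real.exp_pos _, by simpa using hκ,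
    fun ω => (hopK ω).trans (le_max_left _ _), fun ω h => ?_, fun ω h => ?_, fun n ω h hh => ?_,
    fun w hw => hw.piecewise_transfer hAm
      (fun ω hω => (congrArg Variation.Space.val (Equiv.piCongrLeft_apply_apply S.B _ _ ω)).trans
        (hopA ω hω _))
      (fun ω hω => (Equiv.piCongrLeft_apply_apply S.B S.σ.toEquiv _ ω).trans
        (congrArg (· (w ω)) (hopc ω hω)))⟩, hAae.mono hopA⟩ <;> by_cases hω : ω ∈ A
  · rw [hopA ω hω]; exact norm_transfer_le ω _
  · rw [hopc ω hω]; exact norm_val_averageCLM_le ω h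
  · rw [Variation.intCLM_apply, hopA ω hω]
    exact integral_transferL1 (S.measurable_fiberMap ω) (S.nonsingular ω) (L1.integrable_coeFn _)
  · rw [hopc ω hω, intCLM_averageCLM]
  · refine (norm_cocycleIter_le_of_eq_transfer (fun k => hopA _ (hAσ.iterate k hω)) hC.le n
      ((hA ω hω).2 n _ h.var_lt_top hh)).trans ?_
    gcongr
    exact le_max_right _ _
  · exact norm_cocycleIter_le_of_eq_averageCLM (hopc ω hω)
      ((le_max_left _ _).trans (le_max_left _ _)) (Real.exp_pos _).le n hh

end RandomSystem

theorem ae_eq_const_of_tendsto_iterate {α E : Type*} [MeasurableSpace α] {μ : Measure α}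
    [IsFiniteMeasure μ] [MetricSpace E] {τ : α → α} (hτ : MeasurePreserving τ μ μ) {d : α → E}
    (hd : AEStronglyMeasurable d μ) {c : E}
    (h : ∀ᵐ a ∂μ, Tendsto (fun n => d (τ^[n] a)) atTop (𝓝 c)) : d =ᵐ[μ] fun _ => c := by
  have hcomp : TendstoInMeasure μ (fun n => d ∘ τ^[n]) atTop fun _ => c :=
    tendstoInMeasure_of_tendsto_ae
      (fun n => hd.comp_measurePreserving (hτ.iterate n)) h
  have hconst : TendstoInMeasure μ (fun _ : ℕ => d) atTop fun _ => c := fun ε hε =>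
    (hcomp ε hε).congr fun n => (hτ.iterate n).measure_preimage
      (nullMeasurableSet_le aemeasurable_const (hd.edist aestronglyMeasurable_const))
  exact tendstoInMeasure_ae_unique
    (tendstoInMeasure_of_tendsto_ae (fun _ => hd) (ae_of_all _ fun _ => tendsto_const_nhds)) hconst

namespace RandomSystem

variable {Ω X : Type*} [MeasurableSpace Ω] {ℙ : Measure Ω} [MetricSpace X] [MeasurableSpace X]
  {S : RandomSystem Ω X ℙ}

open BoundedFamily

theorem exists_boundedFamily_of_ae_bounded {F : S.𝒳 → ℝ} (hF : Measurable F)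
    (hFB : ∀ ω, ∃ f : S.B ω, f.val =ᵐ[S.m ω] csect F ω)
    (hFbdd : ∃ M : ℝ, ∀ᵐ ω ∂ℙ, ∀ f : S.B ω, f.val =ᵐ[S.m ω] csect F ω → ‖f‖ ≤ M) :
    ∃ f : S.BoundedFamily, ∀ᵐ ω ∂ℙ, (eval ω f).val =ᵐ[S.m ω] csect F ω := by
  choose f hf using hFB
  obtain ⟨M, hM⟩ := hFbdd
  obtain ⟨A, hA, -, hAae, hAM⟩ :=
    exists_measurableSet_mapsTo_of_ae (Measure.QuasiMeasurePreserving.id ℙ) hM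
  have hmeas : S.MeasurableVec f := ⟨fun p => F p, Complex.measurable_ofReal.comp hF, hf⟩
  refine ⟨BoundedFamily.mk _ (hmeas.smul (measurable_one.indicator hA)) |M| fun ω => ?_,
    hAae.mono fun ω hω => ?_⟩
  · by_cases hω : ω ∈ A
    · simpa [hω] using (hAM ω hω _ (hf ω)).trans (le_abs_self M)
    · simp [hω]
  · rw [eval_mk, Set.indicator_of_mem hω, Pi.one_apply, one_smul]
    exact hf ω

theorem MeasurableVec.exists_nonneg_version {w : ∀ ω, S.B ω} (hw : S.MeasurableVec w)
    (hnonneg : ∀ ω, NonnegL1 (w ω).val) : ∃ g : S.𝒳 → ℝ,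
      Measurable g ∧ (∀ p, 0 ≤ g p) ∧ ∀ ω, (w ω).val =ᵐ[S.m ω] csect g ω := by
  obtain ⟨g, hg, hgw⟩ := hw
  refine ⟨fun p => max (g p).re 0, (Complex.measurable_re.comp hg).max measurable_const,
    fun p => le_max_right _ _, fun ω => ?_⟩
  filter_upwards [hgw ω, hnonneg ω] with x hx hx0
  rw [hx] at hx0 ⊢
  exact Complex.ext (max_eq_left hx0.2).symm hx0.1

namespace IsEquivariantDensity

variable {w : S.𝒳 → ℝ} (hw : S.IsEquivariantDensity w)

include hw

theorem exists_ae_eq_csect : ∃ W : ∀ ω, Lp ℂ 1 (S.m ω), ∀ᵐ ω ∂ℙ, W ω =ᵐ[S.m ω] csect w ω ∧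
    NonnegL1 (W ω) ∧ ‖W ω‖ = 1 ∧ S.transfer ω (W ω) = W (S.σ ω) := by
  have hW : ∀ ω, ∃ W : Lp ℂ 1 (S.m ω),
      ∫ x, sect w ω x ∂(S.m ω) = 1 → W =ᵐ[S.m ω] csect w ω := fun ω => by
    by_cases hmass : ∫ x, sect w ω x ∂(S.m ω) = 1
    · have hi := (integrable_of_integral_eq_one hmass).ofReal (𝕜 := ℂ)
      exact ⟨hi.toL1 _, fun _ => hi.coeFn_toL1⟩
    · exact ⟨0, fun h => absurd h hmass⟩
  choose W hW using hW
  refine ⟨W, ?_⟩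
  filter_upwards [hw.integral_eq_one, S.ergodic.toMeasurePreserving.quasiMeasurePreserving.ae
    hw.integral_eq_one, hw.equivariant] with ω hmass hmass' hequiv
  have hnonneg : NonnegL1 (W ω) := (hW ω hmass).mono fun x hx => by
    rw [hx]
    exact ⟨Complex.ofReal_im _, hw.nonneg _⟩
  refine ⟨hW ω hmass, hnonneg, ?_, ?_⟩
  · have hnorm := nonnegL1_iff_norm_eq_integral.1 hnonneg
    have hcint : ∫ x, csect w ω x ∂(S.m ω) = 1 :=
      integral_complex_ofReal.trans (by rw [hmass, Complex.ofReal_one])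
    rw [integral_congr_ae (hW ω hmass), hcint] at hnorm
    exact_mod_cast hnorm
  · rw [transfer, transferL1_congr (hW ω hmass)]
    exact Lp.ext (hequiv.trans (hW _ hmass').symm)

end IsEquivariantDensity

theorem norm_transferIter_sub_le (n : ℕ) (ω : Ω) (φ ψ : Lp ℂ 1 (S.m ω)) :
    ‖S.transferIter n ω φ - S.transferIter n ω ψ‖ ≤ ‖φ - ψ‖ := by
  induction n generalizing ω with
  | zero => rfl
  | succ n ih =>
    refine (ih (S.σ ω) _ _).trans ?_
    have hsub : S.transfer ω φ - S.transfer ω ψ = S.transfer ω (φ - ψ) :=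
      sub_eq_of_eq_add (by rw [← transfer_add, sub_add_cancel])
    rw [hsub]
    exact norm_transfer_le ω _

theorem transferIter_eq_of_forall_transfer_eq {W : ∀ ω, Lp ℂ 1 (S.m ω)} {ω : Ω}
    (h : ∀ k, S.transfer (S.σ^[k] ω) (W (S.σ^[k] ω)) = W (S.σ (S.σ^[k] ω))) (n : ℕ) :
    S.transferIter n ω (W ω) = W (S.σ^[n] ω) := by
  induction n generalizing ω with
  | zero => rfl
  | succ n ih =>
    have h0 : S.transfer ω (W ω) = W (S.σ ω) := h 0
    rw [transferIter, h0]
    exact ih fun k => h (k + 1)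

namespace RegularCocycle

variable {R : S.RegularCocycle}

theorem isTwisted_twisted {F : S.𝒳 → ℝ} {f : S.BoundedFamily} {ω : Ω}
    (hR : ∀ φ, (R.op ω φ).val = S.transfer ω φ.val) (hf : (eval ω f).val =ᵐ[S.m ω] csect F ω)
    (θ : ℂ) : S.IsTwisted F θ ω (R.twisted f θ ω) := fun φ =>
  (hR _).trans (transferL1_congr ((Variation.exp_mulCLM_ae_eq _ φ θ).trans
    (hf.mono fun x hx => by simp only [hx])))

variable {v : S.BoundedFamily} (hfix : R.familyOp v = v)

include hfix

theorem exists_isEquivariantDensity (hR : ∀ᵐ ω ∂ℙ, ∀ φ, (R.op ω φ).val = S.transfer ω φ.val)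
    (hv : ∀ ω, ‖(eval ω v).val‖ ≤ 1 ∧ (S.V ω).intCLM (eval ω v) = 1) :
    ∃ g : S.𝒳 → ℝ, S.IsEquivariantDensity g ∧ ∀ ω, (eval ω v).val =ᵐ[S.m ω] csect g ω := by
  have hnonneg : ∀ ω, NonnegL1 (eval ω v).val := fun ω => by
    have hle := Variation.norm_intCLM_apply_le (eval ω v)
    rw [(hv ω).2, norm_one] at hle
    rw [nonnegL1_iff_norm_eq_integral, ← Variation.intCLM_apply, (hv ω).2,
      (hv ω).1.antisymm hle, Complex.ofReal_one]
  obtain ⟨g, hg, hg0, hgv⟩ := (measurableVec_eval v).exists_nonneg_version hnonneg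
  refine ⟨g, ⟨hg, hg0, ae_of_all _ fun ω => ?_, hR.mono fun ω hω => ?_⟩, hgv⟩
  · have hmass := (hv ω).2
    rw [Variation.intCLM_apply, integral_congr_ae (hgv ω)] at hmass
    exact_mod_cast integral_complex_ofReal.symm.trans hmass
  · have hequiv := hω (eval ω v)
    rw [← eval_familyOp, hfix, transfer, transferL1_congr (hgv ω)] at hequiv
    exact (hequiv ▸ hgv (S.σ ω) :)

theorem norm_transferIter_sub_eval_le {ω : Ω}
    (hR : ∀ k, ∀ φ, (R.op (S.σ^[k] ω) φ).val = S.transfer (S.σ^[k] ω) φ.val) (n : ℕ)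
    {φ : S.B ω} (hφ : (S.V ω).intCLM φ = (S.V ω).intCLM (eval ω v)) :
    ‖S.transferIter n ω φ.val - (eval (S.σ^[n] ω) v).val‖ ≤ R.K * R.r ^ n * ‖φ - eval ω v‖ := by
  have hpow : (R.familyOp ^ n) v = v := by
    rw [FunLike.coe_pow_eq_iterate]
    exact Function.iterate_fixed hfix n
  have hdecay := (Variation.Space.norm_val_le _).trans
    (R.norm_cocycleIter_le n ω (φ - eval ω v) (by rw [map_sub, hφ, sub_self]))
  rwa [map_sub, Variation.Space.val_sub, val_cocycleIter hR, ← eval_familyOp_pow, hpow] at hdecay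

theorem tendsto_norm_transferIter_sub {ω : Ω}
    (hR : ∀ k, ∀ φ, (R.op (S.σ^[k] ω) φ).val = S.transfer (S.σ^[k] ω) φ.val)
    (hv : (S.V ω).intCLM (eval ω v) = 1) {φ : Lp ℂ 1 (S.m ω)} (hφ : NonnegL1 φ) (hφ1 : ‖φ‖ = 1) :
    Tendsto (fun n => ‖S.transferIter n ω φ - (eval (S.σ^[n] ω) v).val‖) atTop (𝓝 0) := by
  refine tendsto_order.2 ⟨fun a ha => .of_forall fun n => ha.trans_le (norm_nonneg _),
    fun ε hε => ?_⟩
  obtain ⟨_, ⟨hψ, hψ1, hψvar⟩, hψφ⟩ := Metric.mem_closure_iff.1 ((S.V ω).dense ⟨hφ, hφ1⟩) ε hε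
  obtain ⟨ψ, rfl⟩ : ∃ ψ : S.B ω, ψ.val = _ := ⟨_, Variation.Space.val_mk _ hψvar⟩
  rw [dist_eq_norm] at hψφ
  have hmass : (S.V ω).intCLM ψ = (S.V ω).intCLM (eval ω v) := by
    rw [hv, Variation.intCLM_apply, ← nonnegL1_iff_norm_eq_integral.1 hψ, hψ1, Complex.ofReal_one]
  have hlim : Tendsto (fun n => ‖φ - ψ.val‖ + R.K * R.r ^ n * ‖ψ - eval ω v‖) atTop
      (𝓝 ‖φ - ψ.val‖) := by
    simpa using (((tendsto_pow_atTop_nhds_zero_of_lt_one R.pos_r.le R.r_lt_one).const_mul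
      R.K).mul_const ‖ψ - eval ω v‖).const_add ‖φ - ψ.val‖
  filter_upwards [hlim.eventually_lt_const hψφ] with n hn
  exact ((norm_sub_le_norm_sub_add_norm_sub _ (S.transferIter n ω ψ.val) _).trans (add_le_add
    (norm_transferIter_sub_le n ω φ ψ.val) (norm_transferIter_sub_eval_le hfix hR n hmass)))
    |>.trans_lt hn

theorem ae_eq_of_isEquivariantDensity [IsFiniteMeasure ℙ]
    (hR : ∀ᵐ ω ∂ℙ, ∀ φ, (R.op ω φ).val = S.transfer ω φ.val)
    (hv : ∀ ω, (S.V ω).intCLM (eval ω v) = 1) {g w : S.𝒳 → ℝ} (hg : Measurable g)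
    (hgv : ∀ ω, (eval ω v).val =ᵐ[S.m ω] csect g ω) (hw : S.IsEquivariantDensity w) :
    ∀ᵐ ω ∂ℙ, sect w ω =ᵐ[S.m ω] sect g ω := by
  have hσ := S.ergodic.toMeasurePreserving
  obtain ⟨W, hW⟩ := hw.exists_ae_eq_csect
  set d : Ω → ℝ := fun ω => ∫ x, sect (fun p => |w p - g p|) ω x ∂(S.m ω)
  have hd : ∀ᵐ ω ∂ℙ, d ω = ‖W ω - (eval ω v).val‖ := hW.mono fun ω hω => by
    rw [L1.norm_eq_integral_norm]
    refine integral_congr_ae ?_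
    filter_upwards [hω.1, hgv ω, Lp.coeFn_sub (W ω) (eval ω v).val] with x hwx hgx hsub
    rw [hsub, Pi.sub_apply, hwx, hgx, csect, csect, ← Complex.ofReal_sub, Complex.norm_real]
    rfl
  have hlim : ∀ᵐ ω ∂ℙ, Tendsto (fun n => d (S.σ^[n] ω)) atTop (𝓝 0) := by
    filter_upwards [hW, ae_all_iff.2 fun n =>
      (hσ.iterate n).quasiMeasurePreserving.ae (hR.and (hW.and hd))] with ω hω horbit
    refine (tendsto_norm_transferIter_sub hfix (fun k => (horbit k).1) (hv ω) hω.2.1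
      hω.2.2.1).congr fun n => ?_
    rw [(horbit n).2.2, transferIter_eq_of_forall_transfer_eq fun k => by
      exact (horbit k).2.1.2.2.2]
  have hzero := ae_eq_const_of_tendsto_iterate hσ
    (S.measurable_m _ (hw.measurable.sub hg).norm).aestronglyMeasurable hlim
  filter_upwards [hW, hd, hzero] with ω hω hdω hzω
  have heq : W ω = (eval ω v).val := sub_eq_zero.1 (norm_eq_zero.1 (hdω.symm.trans hzω))
  filter_upwards [hω.1, hgv ω] with x hwx hgx
  exact Complex.ofReal_injective (hwx.symm.trans (heq ▸ hgx))

end RegularCocycle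

end RandomSystem

end

open RandomSystem RegularCocycle in
theorem mainTheorem8_general {Ω X : Type*} [MeasurableSpace Ω] (ℙ : Measure Ω) [IsFiniteMeasure ℙ]
    [MetricSpace X] [MeasurableSpace X] [MeasurableSpace.CountablyGenerated X]
    (S : RandomSystem Ω X ℙ)
    (hbounded : ∃ K : ℝ, 0 < K ∧ ∀ᵐ ω ∂ℙ, ∀ φ : Lp ℂ 1 (S.m ω), (S.V ω).var φ < ∞ →
      (S.V (S.σ ω)).bnorm (S.transfer ω φ) ≤ ENNReal.ofReal K * (S.V ω).bnorm φ)
    (hdecay : ∃ C κ : ℝ, 0 < C ∧ 0 < κ ∧ ∀ᵐ ω ∂ℙ, ∀ n : ℕ, ∀ φ : Lp ℂ 1 (S.m ω),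
      (S.V ω).var φ < ∞ → ∫ x, φ x ∂(S.m ω) = 0 →
      (S.V (S.σ^[n] ω)).bnorm (S.transferIter n ω φ) ≤
        ENNReal.ofReal (C * Real.exp (-κ * n)) * (S.V ω).bnorm φ)
    (F : S.𝒳 → ℝ) (hF : Measurable F)
    (hFB : ∀ ω, ∃ f : S.B ω, f.val =ᵐ[S.m ω] csect F ω)
    (hFbdd : ∃ M : ℝ, ∀ᵐ ω ∂ℙ, ∀ f : S.B ω, f.val =ᵐ[S.m ω] csect F ω → ‖f‖ ≤ M) :
    ∃ v : S.𝒳 → ℝ, S.IsEquivariantDensity v ∧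
      (∀ w : S.𝒳 → ℝ, S.IsEquivariantDensity w → ∀ᵐ ω ∂ℙ, sect w ω =ᵐ[S.m ω] sect v ω) ∧
    ∃ L : ℂ → ∀ ω, S.B ω →L[ℂ] S.B (S.σ ω),
      (∀ᵐ ω ∂ℙ, ∀ θ : ℂ, S.IsTwisted F θ ω (L θ ω)) ∧
    ∃ U : Set ℂ, IsOpen U ∧ 0 ∈ U ∧
    ∃ (l : ℂ → Ω → ℂ) (u : ℂ → ∀ ω, S.B ω) (φ : ℂ → ∀ ω, S.B ω →L[ℂ] ℂ),
      (∀ᵐ ω ∂ℙ, ∀ θ ∈ U,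
        L θ ω (u θ ω) = l θ ω • u θ (S.σ ω) ∧
        (φ θ (S.σ ω)).comp (L θ ω) = l θ ω • φ θ ω ∧
        φ θ ω (u θ ω) = 1) ∧
      (∀ᵐ ω ∂ℙ, l 0 ω = 1 ∧ (u 0 ω).val =ᵐ[S.m ω] csect v ω ∧
        ∀ h : S.B ω, φ 0 ω h = ∫ x, h.val x ∂(S.m ω)) ∧
      (∀ᵐ ω ∂ℙ, AnalyticOnNhd ℂ (fun θ => l θ ω) U ∧
        AnalyticOnNhd ℂ (fun θ => u θ ω) U ∧ AnalyticOnNhd ℂ (fun θ => φ θ ω) U) ∧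
      (∀ θ ∈ U, Measurable (l θ) ∧ S.MeasurableVec (u θ) ∧ S.MeasurableDual (φ θ)) ∧
      (∃ C : ℝ, 0 < C ∧ ∀ᵐ ω ∂ℙ, ∀ θ ∈ U, ‖l θ ω‖ ≤ C ∧ ‖u θ ω‖ ≤ C ∧ ‖φ θ ω‖ ≤ C) ∧
      (∃ c r : ℝ, 0 < c ∧ 0 < r ∧ r < 1 ∧ ∀ᵐ ω ∂ℙ, ∀ n : ℕ, ∀ h : S.B ω, ∀ θ ∈ U,
        ‖S.iterOp (L θ) n ω h -
            ((∏ i ∈ Finset.range n, l θ (S.σ^[i] ω)) * φ θ ω h) • u θ (S.σ^[n] ω)‖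
          ≤ c * r ^ n * ‖h‖) := by
  obtain ⟨R, hR⟩ := exists_regularCocycle hbounded hdecay
  obtain ⟨f, hf⟩ := exists_boundedFamily_of_ae_bounded hF hFB hFbdd
  obtain ⟨v, hfix, hv⟩ := R.exists_invariant_density
  obtain ⟨g, hg, hgv⟩ := exists_isEquivariantDensity hfix hR hv
  obtain ⟨u, U, δ, C, rfl, H⟩ := exists_isEigenfamily f hfix fun ω => (hv ω).2
  obtain ⟨B, hB, hbound⟩ := H.exists_norm_le
  obtain ⟨c, r, hc, hr0, hr1, hgap⟩ := H.exists_norm_iterOp_sub_le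
  exact ⟨g, hg,
    fun w hw => ae_eq_of_isEquivariantDensity hfix hR (fun ω => (hv ω).2) hg.measurable hgv hw,
    R.twisted f, by filter_upwards [hR, hf] with ω hRω hfω θ using isTwisted_twisted hRω hfω θ,
    U, H.isOpen, H.zero_mem,
    R.eigenvalue f u, fun θ ω => BoundedFamily.eval ω (u θ), R.eigenfunctional f u,
    ae_of_all _ fun ω θ hθ => ⟨H.twisted_eigenvector hθ ω, H.eigenfunctional_comp hθ ω,
      H.eigenfunctional_eigenvector hθ ω⟩,
    ae_of_all _ fun ω => ⟨H.eigenvalue_zero ω, hgv ω, fun h => by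
      rw [H.eigenfunctional_zero, Variation.intCLM_apply]⟩,
    ae_of_all _ fun ω => ⟨(H.differentiableOn_eigenvalue ω).analyticOnNhd H.isOpen,
      (H.differentiableOn_eigenvector ω).analyticOnNhd H.isOpen,
      (H.differentiableOn_eigenfunctional ω).analyticOnNhd H.isOpen⟩,
    fun θ hθ => ⟨R.measurable_eigenvalue f u θ, BoundedFamily.measurableVec_eval (u θ),
      H.measurableDual hθ⟩,
    ⟨B, hB, ae_of_all _ fun ω θ hθ => by simpa only [max_le_iff] using hbound ω θ hθ⟩,
    c, r, hc, hr0, hr1, ae_of_all _ hgap⟩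

theorem mainTheorem8 {Ω X : Type*} [MeasurableSpace Ω] (ℙ : Measure Ω) [IsProbabilityMeasure ℙ]
    [MetricSpace X] [CompactSpace X] [MeasurableSpace X] [BorelSpace X]
    (S : RandomSystem Ω X ℙ) (hS : S.Admissible)
    (F : S.𝒳 → ℝ) (hF : Measurable F)
    (hFB : ∀ ω, ∃ f : S.B ω, f.val =ᵐ[S.m ω] csect F ω)
    (hFbdd : ∃ M : ℝ, ∀ᵐ ω ∂ℙ, ∀ f : S.B ω, f.val =ᵐ[S.m ω] csect F ω → ‖f‖ ≤ M) :
    -- the essentially unique equivariant density `v`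
    ∃ v : S.𝒳 → ℝ, S.IsEquivariantDensity v ∧
      (∀ w : S.𝒳 → ℝ, S.IsEquivariantDensity w → ∀ᵐ ω ∂ℙ, sect w ω =ᵐ[S.m ω] sect v ω) ∧
    -- the twisted operators are well-defined bounded operators `𝓑_ω → 𝓑_{σω}`
    ∃ L : ℂ → ∀ ω, S.B ω →L[ℂ] S.B (S.σ ω),
      (∀ᵐ ω ∂ℙ, ∀ θ : ℂ, S.IsTwisted F θ ω (L θ ω)) ∧
    ∃ U : Set ℂ, IsOpen U ∧ 0 ∈ U ∧
    ∃ (l : ℂ → Ω → ℂ) (u : ℂ → ∀ ω, S.B ω) (φ : ℂ → ∀ ω, S.B ω →L[ℂ] ℂ),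
      -- (1) eigenvectors, dual eigenfunctionals, normalization
      (∀ᵐ ω ∂ℙ, ∀ θ ∈ U,
        L θ ω (u θ ω) = l θ ω • u θ (S.σ ω) ∧
        (φ θ (S.σ ω)).comp (L θ ω) = l θ ω • φ θ ω ∧
        φ θ ω (u θ ω) = 1) ∧
      -- (2) the triplet at `θ = 0`
      (∀ᵐ ω ∂ℙ, l 0 ω = 1 ∧ (u 0 ω).val =ᵐ[S.m ω] csect v ω ∧
        ∀ h : S.B ω, φ 0 ω h = ∫ x, h.val x ∂(S.m ω)) ∧
      -- (3) analyticity
      (∀ᵐ ω ∂ℙ, AnalyticOnNhd ℂ (fun θ => l θ ω) U ∧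
        AnalyticOnNhd ℂ (fun θ => u θ ω) U ∧ AnalyticOnNhd ℂ (fun θ => φ θ ω) U) ∧
      -- (4) measurability
      (∀ θ ∈ U, Measurable (l θ) ∧ S.MeasurableVec (u θ) ∧ S.MeasurableDual (φ θ)) ∧
      -- (5) uniform bounds
      (∃ C : ℝ, 0 < C ∧ ∀ᵐ ω ∂ℙ, ∀ θ ∈ U, ‖l θ ω‖ ≤ C ∧ ‖u θ ω‖ ≤ C ∧ ‖φ θ ω‖ ≤ C) ∧
      -- (6) exponential spectral gap
      (∃ c r : ℝ, 0 < c ∧ 0 < r ∧ r < 1 ∧ ∀ᵐ ω ∂ℙ, ∀ n : ℕ, ∀ h : S.B ω, ∀ θ ∈ U,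
        ‖S.iterOp (L θ) n ω h -
            ((∏ i ∈ Finset.range n, l θ (S.σ^[i] ω)) * φ θ ω h) • u θ (S.σ^[n] ω)‖
          ≤ c * r ^ n * ‖h‖) :=
  mainTheorem8_general ℙ S hS.bounded hS.decay F hF hFB hFbdd
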